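/- **Definitions.** A *family* on a set $I$ is a collection $\mathcal F$ of finite subsets of $I$. It is *hereditary* if closed under subsets, and *compact* if it is closed in $2^I$ (sets identified with characteristic functions). For a nonempty compact family, $\mathrm{rk}(\mathcal F)$ is the ordinal $\alpha$ such that the Cantor–Bendixson rank of $\mathcal F$ is $\alpha+1$. For $A\subseteq I$ put $\mathcal F\upharpoonright A=\{s\in\mathcal F: s\subseteq A\}$. Let $P$ be a partially ordered set with an infinite chain. A family *on chains of $P$* is a family on $P$ whose members are chains; $[P]^{\le n}$ is the family of all chains with at most $n$ elements. Put $\mathrm{srk}(\mathcal F)=\inf\{\mathrm{rk}(\mathcal F\upharpoonright C): C \text{ an infinite chain of } P\}$. Let $\iota(\alpha)$ be the least $\lambda>\alpha$ among the infinite ordinals closed under ordinal exponentiation ($\omega,\varepsilon_0,\varepsilon_1,\dots$). A compact hereditary family $\mathcal F$ on chains of $P$ is *homogeneous* if either $\mathcal F=\{\emptyset\}$, or $[P]^{\le 1}\subseteq\mathcal F$ and $1\le\mathrm{srk}(\mathcal F)\le \mathrm{rk}(\mathcal F)<\iota(\mathrm{srk}(\mathcal F))$ with $\mathrm{srk}(\mathcal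 F)<\omega_1$. Put $\mathcal F\sqcup_P\mathcal G=\{s\cup t: s\in\mathcal F,\ t\in\mathcal G,\ s\cup t\text{ a chain}\}$. For a family $\mathcal F$ on $\omega$ let $\mathcal F_{\{n\}}=\{s: n<\min s \text{ or } s=\emptyset,\ \{n\}\cup s\in\mathcal F\}$. For infinite $M\subseteq\omega$ and $n\in M$ let $M/n=\{m\in M: m>n\}$. A family $\mathcal F$ on $M$ with $\emptyset\in\mathcal F$ is *$\alpha$-uniform on $M$* if: $\alpha=0$ and $\mathcal F=\{\emptyset\}$; or $\alpha=\beta+1$ and every $\mathcal F_{\{n\}}$, $n\in M$, is $\beta$-uniform on $M/n$; or $\alpha$ is a limit ordinal and there is a non-decreasing $(\alpha_n)_{n\in M}$ of ordinals below $\alpha$ with supremum $\alpha$ such that each $\mathcal F_{\{n\}}$ is $\alpha_n$-uniform on $M/n$. A family on $\omega$ is *spreading* if $\{m_0<\dots<m_k\}\in\mathcal F$, $n_0<\dots<n_k$ and $m_i\le n_i$ for all $i\le k$ imply $\{n_0,\dots,n_k\}\in\mathcal F$. Let $\mathfrak S$ be the collection of all hereditary spreading families that are $\alpha$-uniform on $\omega$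 for some $\alpha<\omega_1$. For $\mathcal F$ homogeneous on chains of $P$ and $\mathcal H\in\mathfrak S$, a family $\mathcal G$ on chains of $P$ is a *multiplication of $\mathcal F$ by $\mathcal H$* if $\mathcal G$ is homogeneous, $\iota(\mathrm{srk}(\mathcal G))=\iota(\mathrm{srk}(\mathcal F)\cdot\mathrm{srk}(\mathcal H))$, and every sequence $(s_n)_{n<\omega}$ in $\mathcal F$ whose union is a chain has a subsequence $(t_n)_{n<\omega}$ with $\bigcup_{n\in x}t_n\in\mathcal G$ for all $x\in\mathcal H$. A *basis of families* on chains of $P$ is a pair $(\mathfrak B,\times)$ such that: 1. $\mathfrak B$ consists of homogeneous families on chains of $P$, contains $[P]^{\le n}$ for all $n<\omega$, and for each $\omega\le\alpha<\omega_1$ contains some $\mathcal F$ with $\mathrm{srk}(\mathcal F)=\alpha$; 2. $\mathfrak B$ is closed under $\cup$ and $\sqcup_P$, and if $\mathcal F\subseteq\mathcal G\in\mathfrak B$, $\mathcal F$ is homogeneous and $\iota(\mathrm{srk}(\mathcal F))=\iota(\mathrm{srk}(\mathcal G))$, then $\mathcal F\in\mathfrak B$; 3. $\times:\mathfrak B\times\mathfrak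 S\to\mathfrak B$, and $\mathcal F\times\mathcal H$ is a multiplication of $\mathcal F$ by $\mathcal H$ for all $\mathcal F\in\mathfrak B$, $\mathcal H\in\mathfrak S$. An infinite cardinal $\kappa$ *has a basis* if there is a basis of families on chains of the total order $(\kappa,<)$. **Theorem.** Let $\kappa$ be an infinite cardinal. If $\kappa$ has a basis, then $2^\kappa$ has a basis. -/

import Mathlib

open Ordinal Cardinal

universe u

namespace FamilyBases

noncomputable section

/-! ### Families of finite sets, compactness and rank -/

/-- The set of characteristic functions in the Cantor cube `2^I` (product topology, discrete
factors) of the members of a family `F` of finite subsets of `I`. -/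
def cubeImage {I : Type u} (F : Set (Finset I)) : Set (I → Bool) :=
  {f | ∃ s ∈ F, ∀ i, f i = true ↔ i ∈ s}

/-- A family is compact when it is a closed subset of `2^I`. -/
def IsCompactFamily {I : Type u} (F : Set (Finset I)) : Prop :=
  IsClosed (cubeImage F)

/-- A family is hereditary when it is closed under subsets. -/
def IsHereditary {I : Type u} (F : Set (Finset I)) : Prop :=
  ∀ s ∈ F, ∀ t : Finset I, t ⊆ s → t ∈ F

/-- The Cantor-Bendixson rank of a subset `A` of a topological space (with the subspace
topology): the least `α` with `A^(α+1) = A^(α)`. -/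
def cbRank {X : Type u} [TopologicalSpace X] (A : Set X) : Ordinal.{u} :=
  sInf {α | CantorBendixson.iteratedDerivedSet A (α + 1) =
    CantorBendixson.iteratedDerivedSet A α}

/-- The rank `rk F`: the predecessor of the Cantor-Bendixson rank (which is a successor ordinal
when `F` is a nonempty compact family). -/
def rk {I : Type u} (F : Set (Finset I)) : Ordinal.{u} :=
  Ordinal.pred (cbRank (cubeImage F))

/-- The restriction of a family to the subsets of `A`. -/
def restrict {I : Type u} (F : Set (Finset I)) (A : Set I) : Set (Finset I) :=
  {s | s ∈ F ∧ (s : Set I) ⊆ A}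

section PartialOrder

variable {P : Type u} [PartialOrder P]

/-- A set is a chain when it is totally ordered. -/
def IsCh (A : Set P) : Prop := IsChain (· ≤ ·) A

/-- The members of the family are (finite) chains of `P`. -/
def OnChains (F : Set (Finset P)) : Prop :=
  ∀ s ∈ F, IsCh (s : Set P)

/-- The small rank of `F` relative to `P`: the infimum of the ranks of the restrictions of `F` to
the infinite chains of `P`. -/
def srk (F : Set (Finset P)) : Ordinal.{u} :=
  sInf {α | ∃ C : Set P, C.Infinite ∧ IsCh C ∧ α = rk (restrict F C)}

variable (P) in
/-- The cube `[P]^{≤ n}`: all chains of `P` with at most `n` elements. -/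
def cube (n : ℕ) : Set (Finset P) :=
  {s | IsCh (s : Set P) ∧ s.card ≤ n}

end PartialOrder

/-- An infinite ordinal closed under ordinal exponentiation: `ω, ε₀, ε₁, …`. -/
def ExpIndecomposable (α : Ordinal.{u}) : Prop :=
  ω ≤ α ∧ ∀ β < α, ∀ γ < α, β ^ γ < α

/-- `ι α` is the least exp-indecomposable ordinal above `α`. -/
def iota (α : Ordinal.{u}) : Ordinal.{u} :=
  sInf {l | α < l ∧ ExpIndecomposable l}

section PartialOrder

variable {P : Type u} [PartialOrder P]

/-- `(α, P)`-homogeneous families. -/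
def IsHomogeneousOf (α : Ordinal.{u}) (F : Set (Finset P)) : Prop :=
  OnChains F ∧ IsCompactFamily F ∧ IsHereditary F ∧ α < ω₁ ∧
    (α = 0 → F = {∅}) ∧
    (1 ≤ α → cube P 1 ⊆ F ∧ α = srk F ∧ srk F ≤ rk F ∧ rk F < iota α)

/-- `P`-homogeneous families. -/
def IsHomogeneous (F : Set (Finset P)) : Prop :=
  ∃ α : Ordinal.{u}, IsHomogeneousOf α F

/-- The operation `⊔_P`: unions `s ∪ t` of a member of `F` and a member of `G` that are chains. -/
def chainSup (F G : Set (Finset P)) : Set (Finset P) :=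
  {u | IsCh (u : Set P) ∧ ∃ s ∈ F, ∃ t ∈ G, (u : Set P) = (s : Set P) ∪ (t : Set P)}

end PartialOrder

/-! ### Uniform families on `ω` -/

/-- `M / n`, the elements of `M` above `n`. -/
def tailAbove (M : Set ℕ) (n : ℕ) : Set ℕ := {m | m ∈ M ∧ n < m}

/-- `F_{n} = {s : n < s and {n} ∪ s ∈ F}`. -/
def sectionAt (F : Set (Finset ℕ)) (n : ℕ) : Set (Finset ℕ) :=
  {s | (∀ m ∈ s, n < m) ∧ insert n s ∈ F}

/-- `IsUniform α M F`: `F` is an `α`-uniform family on the infinite set `M ⊆ ω`. Such an `α` is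
automatically countable. -/
inductive IsUniform : Ordinal.{0} → Set ℕ → Set (Finset ℕ) → Prop
  | zero (M : Set ℕ) (hM : M.Infinite) : IsUniform 0 M {∅}
  | succ (β : Ordinal.{0}) (M : Set ℕ) (F : Set (Finset ℕ)) (hM : M.Infinite)
      (hF : ∀ s ∈ F, (s : Set ℕ) ⊆ M) (h0 : ∅ ∈ F)
      (h : ∀ n ∈ M, IsUniform β (tailAbove M n) (sectionAt F n)) : IsUniform (β + 1) M F
  | limit (α : Ordinal.{0}) (M : Set ℕ) (F : Set (Finset ℕ)) (a : ℕ → Ordinal.{0})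
      (hα : Order.IsSuccLimit α) (hM : M.Infinite)
      (hF : ∀ s ∈ F, (s : Set ℕ) ⊆ M) (h0 : ∅ ∈ F)
      (ha : ∀ n ∈ M, a n < α) (hmono : MonotoneOn a M) (hsup : IsLUB (a '' M) α)
      (h : ∀ n ∈ M, IsUniform (a n) (tailAbove M n) (sectionAt F n)) : IsUniform α M F

/-- Spreading families on `ω`. -/
def IsSpreading (F : Set (Finset ℕ)) : Prop :=
  ∀ (k : ℕ) (m n : Fin k → ℕ), StrictMono m → StrictMono n → (∀ i, m i ≤ n i) →
    Finset.univ.image m ∈ F → Finset.univ.image n ∈ F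

/-- The collection `𝔖` of all hereditary, spreading, uniform families on `ω`. -/
def uniformFamilies : Set (Set (Finset ℕ)) :=
  {H | IsHereditary H ∧ IsSpreading H ∧ ∃ α : Ordinal.{0}, IsUniform α Set.univ H}

/-! ### Multiplications and bases -/

section PartialOrder

variable {P : Type u} [PartialOrder P]

open scoped Classical in
/-- `G` is a multiplication of the family `F` on chains of `P` by the family `H` on `ω`. -/
structure IsMultiplication (F : Set (Finset P)) (H : Set (Finset ℕ)) (G : Set (Finset P)) :
    Prop where
  onChains : OnChains G
  homogeneous : IsHomogeneous G
  iota_srk : iota (srk G) = iota (srk F * Ordinal.lift.{u} (srk H))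
  subsequence : ∀ s : ℕ → Finset P, (∀ n, s n ∈ F) → IsCh (⋃ n, (s n : Set P)) →
    ∃ φ : ℕ → ℕ, StrictMono φ ∧ ∀ x ∈ H, x.biUnion (fun n => s (φ n)) ∈ G

variable (P) in
/-- A basis of homogeneous families on chains of a partial ordering `P` that has an infinite
chain. The values of `mul` outside of `carrier × 𝔖` are irrelevant. -/
structure FamilyBasis where
  exists_infinite_chain : ∃ C : Set P, C.Infinite ∧ IsCh C
  carrier : Set (Set (Finset P))
  mul : Set (Finset P) → Set (Finset ℕ) → Set (Finset P)
  homogeneous : ∀ F ∈ carrier, IsHomogeneous F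
  cube_mem : ∀ n : ℕ, cube P n ∈ carrier
  exists_srk_eq : ∀ α : Ordinal.{u}, ω ≤ α → α < ω₁ → ∃ F ∈ carrier, srk F = α
  union_mem : ∀ F ∈ carrier, ∀ G ∈ carrier, F ∪ G ∈ carrier
  chainSup_mem : ∀ F ∈ carrier, ∀ G ∈ carrier, chainSup F G ∈ carrier
  subfamily_mem : ∀ F : Set (Finset P), ∀ G ∈ carrier, F ⊆ G → IsHomogeneous F →
    iota (srk F) = iota (srk G) → F ∈ carrier
  mul_mem : ∀ F ∈ carrier, ∀ H ∈ uniformFamilies, mul F H ∈ carrier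
  mul_isMultiplication : ∀ F ∈ carrier, ∀ H ∈ uniformFamilies, IsMultiplication F H (mul F H)

end PartialOrder

/-- The cardinal `κ` has a basis of families: there is a basis of families on the
initial ordinal of `κ`, with its usual total order. -/
def CardinalHasBasis (κ : Cardinal.{u}) : Prop :=
  Nonempty (FamilyBasis κ.ord.ToType)

end

end FamilyBases

/-!
Both orders are total, so every set is a chain and a basis on `2 ^ κ` only depends on the set of
its points, which are identified with the branches of the full binary tree of height `Q`, the
initial ordinal of `κ`. The only structure used is the first difference `Δ x y ∈ Q` of two branches
(`IsFirstDifference`). A family `K` on the levels induces the family `treeFamily Δ K` of all finite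
sets `s` of branches such that the levels at which the other members of `s` leave `x` form a member
of `K`, for every `x ∈ s`. The new basis (`treeCarrier`) consists of the homogeneous families that
are contained in some cube `[P]^{≤ n}`, or in some `treeFamily Δ K` where `K` is a member of the
given basis of infinite small rank with the same value of `ι`.

*Ranks.* For a compact hereditary family the Cantor-Bendixson derivative of `F` consists of the `s`
with `insert i s ∈ F` for infinitely many `i`, and `rk F` is the number of derivatives that `∅`
survives (`le_rk_iff`). Upper bounds come from potentials, ordinal valued functions that drop
strictly along proper inclusions in `F`: a hereditary family with a potential is compact and its
rank is at most the value at `∅`. Conversely a compact hereditary family has a potential with value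
below `ω * (rk F + 1)` at `∅` (`hasPotential_of_isCompactFamily`). The bound is below `ι (srk F)`
if `F` is homogeneous and `srk F` is infinite, and potentials of `F` and `G` give potentials of
`chainSup F G` (`hasPotential_chainSup`) and of `treeFamily Δ K` (`hasPotential_treeFamily`) below
the same exp-indecomposable ordinals. Conversely every infinite set of branches contains a comb, on
which `treeFamily Δ K` looks like `K`. So `treeFamily Δ K` is homogeneous with the same small rank
as `K`, if that is infinite (`srk_treeFamily`).

*Closure.* If `x ∈ s`, then the levels at which the members of `t` leave `x` are branching levels
along the member of `t` nearest to `x`, up to one level. This gives closure under `chainSup`.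

*Multiplication.* Let `s n` be a sequence in `treeFamily Δ K`, and consider the limit, along a free
ultrafilter, of the trees spanned by the `s n`. As `treeFamily Δ K` is compact, finitely many
branches cover the limit tree (`exists_finset_cover_limitNode`), and along a subsequence two of the
trees meet only inside it (`exists_subseq_limitNode`). Hence a member `x` of some `s n` sees all the
other `s m` only at levels where they leave one fixed branch `p` of the cover. For fixed `p` these
levels form a sequence in `K` and a sequence of points of `Q`, and both are handled by the given
basis (`exists_subseq_mem_treeFamily`). That `H` is spreading lets the finitely many `p` be treated
one after the other. If `srk F * srk H` is finite, a cube is a multiplication.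
-/

namespace FamilyBases

/-! ### Iterated derivatives and potentials -/

open scoped Classical in
/-- `HasRk F α s` says that `s` survives `α` Cantor-Bendixson derivatives of the family `F`, in
combinatorial form: for every `β < α` there are infinitely many `i` such that `insert i s`
survives `β` derivatives. -/
def HasRk {I : Type u} (F : Set (Finset I)) (α : Ordinal.{u}) (s : Finset I) : Prop :=
  s ∈ F ∧ ∀ β : Ordinal.{u}, β < α → {i | HasRk F β (insert i s)}.Infinite
termination_by α

/-- A potential of `F`: an ordinal valued function that drops strictly when a set is enlarged
within `F`. -/
def IsPotential {I : Type u} (F : Set (Finset I)) (Φ : Finset I → Ordinal.{u}) : Prop :=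
  ∀ s t : Finset I, t ∈ F → s ⊂ t → Φ t < Φ s

/-- `F` has a potential whose largest value is below `l`. -/
def HasPotential {I : Type u} (F : Set (Finset I)) (l : Ordinal.{u}) : Prop :=
  ∃ Φ : Finset I → Ordinal.{u}, IsPotential F Φ ∧ Φ ∅ < l

section Families

variable {I : Type u} {F G : Set (Finset I)} {α β l : Ordinal.{u}} {s t : Finset I}

open scoped Classical in
theorem hasRk_iff : HasRk F α s ↔
    s ∈ F ∧ ∀ β : Ordinal.{u}, β < α → {i | HasRk F β (insert i s)}.Infinite := by
  rw [HasRk]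

theorem HasRk.mem (h : HasRk F α s) : s ∈ F := (hasRk_iff.1 h).1

theorem hasRk_zero : HasRk F 0 s ↔ s ∈ F := by
  rw [hasRk_iff]
  exact ⟨fun h => h.1, fun h => ⟨h, fun β hβ => absurd hβ not_lt_zero⟩⟩

theorem HasRk.anti (h : HasRk F α s) (hβ : β ≤ α) : HasRk F β s := by
  rw [hasRk_iff] at h ⊢
  exact ⟨h.1, fun γ hγ => h.2 γ (hγ.trans_le hβ)⟩

open scoped Classical in
theorem hasRk_add_one : HasRk F (α + 1) s ↔ s ∈ F ∧ {i | HasRk F α (insert i s)}.Infinite := by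
  rw [hasRk_iff]
  refine and_congr_right fun _ => ⟨fun h => h α (lt_add_one α), fun h β hβ => ?_⟩
  exact h.mono fun i hi => HasRk.anti hi (Order.lt_add_one_iff.1 hβ)

theorem hasRk_limit (hα : Order.IsSuccLimit α) :
    HasRk F α s ↔ ∀ β < α, HasRk F β s := by
  refine ⟨fun h β hβ => h.anti hβ.le, fun h => ?_⟩
  rw [hasRk_iff]
  refine ⟨(h 0 (by simpa using hα.bot_lt)).mem, fun β hβ => ?_⟩
  exact (hasRk_add_one.1 (h _ (hα.add_one_lt hβ))).2

theorem HasRk.subset (hF : IsHereditary F) (h : HasRk F α s) (hts : t ⊆ s) : HasRk F α t := by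
  classical
  induction α using WellFoundedLT.induction generalizing s t with
  | ind α ih =>
    rw [hasRk_iff] at h ⊢
    refine ⟨hF _ h.1 _ hts, fun β hβ => (h.2 β hβ).mono fun i hi => ?_⟩
    exact ih β hβ hi (Finset.insert_subset_insert _ hts)

/-- Ranks do not decrease along maps that are injective on the support of the family. -/
theorem HasRk.image {J : Type u} {G : Set (Finset J)} {A : Set I} [DecidableEq J] {f : I → J}
    (hf : Set.InjOn f A) (hA : ∀ s ∈ F, (s : Set I) ⊆ A)
    (hFG : ∀ s ∈ F, s.image f ∈ G) (h : HasRk F α s) : HasRk G α (s.image f) := by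
  classical
  induction α using WellFoundedLT.induction generalizing s with
  | ind α ih =>
    rw [hasRk_iff] at h ⊢
    refine ⟨hFG _ h.1, fun β hβ => ?_⟩
    have hinf := h.2 β hβ
    have hsub : {i | HasRk F β (insert i s)} ⊆ A := fun i hi =>
      hA _ (HasRk.mem hi) (by simp)
    refine (hinf.image (hf.mono hsub)).mono ?_
    rintro _ ⟨i, hi, rfl⟩
    have := ih β hβ hi
    rw [Finset.image_insert] at this
    rw [Set.mem_ofPred_eq]
    convert this

theorem HasRk.mono (hFG : F ⊆ G) (h : HasRk F α s) : HasRk G α s := by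
  classical
  simpa using h.image (f := id) (A := Set.univ) Function.injective_id.injOn
    (fun _ _ => Set.subset_univ _) (fun s hs => by simpa using hFG hs)

/-! ### Compactness and the Cantor-Bendixson derivative -/

open scoped Classical in
/-- The characteristic function of a finite set, as a point of the Cantor cube. -/
noncomputable def chi (s : Finset I) : I → Bool := fun i => decide (i ∈ s)

theorem cubeImage_eq : cubeImage F = chi '' F := by
  ext f
  constructor
  · rintro ⟨s, hs, h⟩
    refine ⟨s, hs, funext fun i => ?_⟩
    have := h i
    by_cases hi : i ∈ s
    · rw [this.2 hi]
      simp [chi, hi]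
    · rw [Bool.eq_false_iff.2 fun h' => hi (this.1 h')]
      simp [chi, hi]
  · rintro ⟨s, hs, rfl⟩
    exact ⟨s, hs, fun i => by simp [chi]⟩

theorem chi_injective : Function.Injective (chi : Finset I → I → Bool) := by
  intro s t h
  ext i
  have := congrFun h i
  simpa [chi] using this

theorem nhds_cube_basis {f : I → Bool} {U : Set (I → Bool)} (hU : U ∈ nhds f) :
    ∃ J : Finset I, ∀ g : I → Bool, (∀ i ∈ J, g i = f i) → g ∈ U := by
  obtain ⟨V, hVU, hV, hfV⟩ := mem_nhds_iff.1 hU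
  obtain ⟨J, v, hv, hJ⟩ := isOpen_pi_iff.1 hV f hfV
  refine ⟨J, fun g hg => hVU (hJ fun i hi => ?_)⟩
  rw [hg i hi]
  exact (hv i hi).2

theorem agree_mem_nhds (f : I → Bool) (J : Finset I) :
    {g : I → Bool | ∀ i ∈ J, g i = f i} ∈ nhds f := by
  have : {g : I → Bool | ∀ i ∈ J, g i = f i} = ⋂ i ∈ J, {g : I → Bool | g i = f i} := by
    ext g; simp
  rw [this, Filter.biInter_finset_mem]
  intro i _
  have hc : Continuous fun g : I → Bool => g i := continuous_apply i
  exact (hc.isOpen_preimage {f i} (isOpen_discrete _)).mem_nhds rfl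

/-- A hereditary family is compact when no infinite set has all its finite subsets in it. -/
theorem isCompactFamily_iff (hF : IsHereditary F) :
    IsCompactFamily F ↔ ∀ A : Set I, A.Infinite → ∃ s : Finset I, (s : Set I) ⊆ A ∧ s ∉ F := by
  classical
  constructor
  · intro h A hA
    by_contra! hcon
    have hmem : (fun i => decide (i ∈ A) : I → Bool) ∈ cubeImage F := by
      rw [← IsClosed.closure_eq h, mem_closure_iff_nhds]
      intro U hU
      obtain ⟨J, hJ⟩ := nhds_cube_basis hU
      refine ⟨chi (J.filter (· ∈ A)), hJ _ fun i hi => by simp [chi, hi], ?_⟩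
      rw [cubeImage_eq]
      exact ⟨_, hcon _ (by intro i; simp), rfl⟩
    obtain ⟨s, -, hs⟩ := hmem
    refine hA (s.finite_toSet.subset fun i hi => ?_)
    exact (hs i).1 (by simpa using hi)
  · intro h
    refine isClosed_of_closure_subset fun f hf => ?_
    rw [mem_closure_iff_nhds] at hf
    have key : ∀ t : Finset I, (t : Set I) ⊆ {i | f i = true} → t ∈ F := by
      intro t ht
      obtain ⟨g, hg, s, hs, hgs⟩ := hf _ (agree_mem_nhds f t)
      refine hF s hs t fun i hi => (hgs i).1 ?_
      rw [hg i hi]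
      exact ht hi
    have hfin : {i | f i = true}.Finite := by
      by_contra hinf
      obtain ⟨s, hs, hs'⟩ := h _ hinf
      exact hs' (key s hs)
    exact ⟨hfin.toFinset, key _ (by simp), fun i => by simp⟩

theorem isCompactFamily_of_hasPotential (hF : IsHereditary F) (h : HasPotential F l) :
    IsCompactFamily F := by
  classical
  rw [isCompactFamily_iff hF]
  intro A hA
  by_contra! hcon
  obtain ⟨Φ, hΦ, -⟩ := h
  let f := hA.natEmbedding
  let g : ℕ → Finset I := fun n => (Finset.range n).image fun k => (f k : I)
  have hg : ∀ n, g n ⊂ g (n + 1) := by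
    intro n
    refine Finset.ssubset_iff_of_subset
      (Finset.image_subset_image (Finset.range_subset_range.2 n.le_succ)) |>.2 ⟨f n, ?_, ?_⟩
    · exact Finset.mem_image_of_mem _ (by simp)
    · simp only [Finset.mem_image, Finset.mem_range, not_exists, not_and]
      intro k hk hkn
      exact hk.ne (f.injective (Subtype.ext hkn))
  have hlt : ∀ n, Φ (g (n + 1)) < Φ (g n) := fun n => by
    refine hΦ _ _ (hcon _ ?_) (hg n)
    intro i hi
    simp only [g, Finset.coe_image, Set.mem_image] at hi
    obtain ⟨k, -, rfl⟩ := hi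
    exact (f k).2
  exact (RelEmbedding.natGT (r := (· < ·)) (fun n => Φ (g n)) hlt).not_wellFounded
    wellFounded_lt

theorem HasPotential.subset (hFG : F ⊆ G) (h : HasPotential G l) : HasPotential F l := by
  obtain ⟨Φ, hΦ, h0⟩ := h
  exact ⟨Φ, fun s t ht => hΦ s t (hFG ht), h0⟩

theorem HasPotential.mono {l' : Ordinal.{u}} (h : HasPotential F l) (hl : l ≤ l') :
    HasPotential F l' := by
  obtain ⟨Φ, hΦ, h0⟩ := h
  exact ⟨Φ, hΦ, h0.trans_le hl⟩

theorem IsPotential.le_of_subset {Φ : Finset I → Ordinal.{u}} (hΦ : IsPotential F Φ)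
    (ht : t ∈ F) (hst : s ⊆ t) : Φ t ≤ Φ s := by
  rcases hst.eq_or_ssubset with rfl | h
  · exact le_rfl
  · exact (hΦ s t ht h).le

/-- For hereditary families it suffices that the potential drops when one point is added. -/
theorem isPotential_of_insert {Φ : Finset I → Ordinal.{u}} [DecidableEq I] (hF : IsHereditary F)
    (h : ∀ s i, i ∉ s → insert i s ∈ F → Φ (insert i s) < Φ s) : IsPotential F Φ := by
  intro s t
  induction t using Finset.strongInduction with
  | H t ih =>
    intro ht hst
    obtain ⟨i, hit, his⟩ := Finset.exists_of_ssubset hst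
    have hins : insert i (t.erase i) = t := Finset.insert_erase hit
    have h1 : Φ t < Φ (t.erase i) := by
      have := h (t.erase i) i (by simp) (by rwa [hins])
      rwa [hins] at this
    have hsub : s ⊆ t.erase i := fun j hj => Finset.mem_erase.2
      ⟨fun hji => his (hji ▸ hj), hst.1 hj⟩
    rcases hsub.eq_or_ssubset with heq | hss
    · rwa [heq]
    · exact h1.trans (ih _ (Finset.erase_ssubset hit) (hF _ ht _ (Finset.erase_subset _ _)) hss)

theorem HasRk.le_potential {Φ : Finset I → Ordinal.{u}} (hΦ : IsPotential F Φ)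
    (h : HasRk F α s) : α ≤ Φ s := by
  classical
  induction α using WellFoundedLT.induction generalizing s with
  | ind α ih =>
    refine le_of_forall_lt fun β hβ => ?_
    obtain ⟨i, hi, his⟩ := ((hasRk_iff.1 h).2 β hβ).exists_notMem_finset s
    exact (ih β hβ hi).trans_lt (hΦ _ _ (HasRk.mem hi) (Finset.ssubset_insert his))

theorem wellFounded_of_isCompactFamily (hF : IsHereditary F) (hc : IsCompactFamily F) :
    WellFounded fun t s : Finset I => t ∈ F ∧ s ⊂ t := by
  classical
  rw [isCompactFamily_iff hF] at hc
  rw [wellFounded_iff_isEmpty_descending_chain]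
  refine ⟨?_⟩
  rintro ⟨f, hf⟩
  have hmono : StrictMono f := strictMono_nat_of_lt_succ fun n => (hf n).2
  have hinf : (⋃ n, (f n : Set I)).Infinite := by
    intro hfin
    have hb : ∀ n, f n ⊆ hfin.toFinset := fun n i hi => by
      simp only [Set.Finite.mem_toFinset, Set.mem_iUnion]
      exact ⟨n, hi⟩
    have : (hfin.toFinset.powerset : Set (Finset I)).Infinite := by
      refine (Set.infinite_range_of_injective hmono.injective).mono ?_
      rintro _ ⟨n, rfl⟩
      simpa only [Finset.mem_coe, Finset.mem_powerset] using hb n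
    exact this (Finset.finite_toSet _)
  obtain ⟨s, hs, hs'⟩ := hc _ hinf
  have hd : Directed (· ⊆ ·) fun n => (f n : Set I) :=
    directed_of_isDirected_le fun a b hab => by
      simpa using hmono.monotone hab
  obtain ⟨n, hn⟩ := hd.exists_mem_subset_of_finset_subset_biUnion hs
  exact hs' (hF _ (hf n).1 _ (by
    intro i hi
    exact (hf n).2.1 (by simpa using hn hi)))

theorem exists_isPotential (hF : IsHereditary F) (hc : IsCompactFamily F) :
    ∃ Φ : Finset I → Ordinal.{u}, IsPotential F Φ := by
  have : IsWellFounded (Finset I) fun t s : Finset I => t ∈ F ∧ s ⊂ t :=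
    ⟨wellFounded_of_isCompactFamily hF hc⟩
  exact ⟨IsWellFounded.rank fun t s : Finset I => t ∈ F ∧ s ⊂ t,
    fun s t ht hst => IsWellFounded.rank_lt_of_rel ⟨ht, hst⟩⟩

theorem exists_hasRk_iff_le (hF : IsHereditary F) (hc : IsCompactFamily F) (hs : s ∈ F) :
    ∃ r : Ordinal.{u}, ∀ α, HasRk F α s ↔ α ≤ r := by
  obtain ⟨Φ, hΦ⟩ := exists_isPotential hF hc
  let S : Set Ordinal.{u} := {α | ¬ HasRk F α s}
  have hS : S.Nonempty := ⟨Φ s + 1, fun h => (h.le_potential hΦ).not_gt (lt_add_one _)⟩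
  have hm : sInf S ∈ S := csInf_mem hS
  have hlt : ∀ α < sInf S, HasRk F α s := fun α hα => by
    by_contra h
    exact (csInf_le' (show α ∈ S from h)).not_gt hα
  rcases Ordinal.zero_or_succ_or_isSuccLimit (sInf S) with h0 | ⟨r, hr⟩ | hl
  · rw [h0] at hm
    exact absurd (hasRk_zero.2 hs) hm
  · refine ⟨r, fun α => ⟨fun h => ?_, fun h => hlt α ?_⟩⟩
    · by_contra! hlt'
      have : r + 1 ≤ α := Order.add_one_le_of_lt hlt'
      refine hm (h.anti ?_)
      rwa [← hr]
    · rw [← hr]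
      exact Order.lt_succ_iff.2 h
  · exact absurd ((hasRk_limit hl).2 hlt) hm

theorem accPt_chi_iff (hF : IsHereditary F) [DecidableEq I] :
    AccPt (chi s) (Filter.principal (cubeImage F)) ↔ {i | insert i s ∈ F}.Infinite := by
  rw [accPt_iff_nhds, cubeImage_eq]
  constructor
  · intro h hfin
    obtain ⟨_, ⟨hag, t, ht, rfl⟩, hne⟩ := h _ (agree_mem_nhds (chi s) (hfin.toFinset ∪ s))
    have hst : s ⊆ t := fun i hi => by
      have := hag i (Finset.mem_union_right _ hi)
      simpa [chi, hi] using this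
    have hss : s ⊂ t := hst.ssubset_of_ne fun h => hne (by rw [h])
    obtain ⟨j, hjt, hjs⟩ := Finset.exists_of_ssubset hss
    have hj : insert j s ∈ F := hF t ht _ (Finset.insert_subset hjt hst)
    have := hag j (Finset.mem_union_left _ (by simpa using hj))
    simp [chi, hjt, hjs] at this
  · intro h U hU
    obtain ⟨J, hJ⟩ := nhds_cube_basis hU
    obtain ⟨i, hi, hiJ⟩ := h.exists_notMem_finset (J ∪ s)
    rw [Finset.mem_union, not_or] at hiJ
    refine ⟨chi (insert i s), ⟨hJ _ fun j hj => ?_, _, hi, rfl⟩, fun h => ?_⟩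
    · have : j ≠ i := fun h => hiJ.1 (h ▸ hj)
      simp [chi, this]
    · have := chi_injective h
      exact hiJ.2 (this ▸ Finset.mem_insert_self i s)

theorem iteratedDerivedSet_cubeImage (hF : IsHereditary F) (α : Ordinal.{u}) :
    CantorBendixson.iteratedDerivedSet (cubeImage F) α = cubeImage {s | HasRk F α s} := by
  classical
  induction α using Ordinal.limitRecOn with
  | zero => simp [hasRk_zero]
  | add_one α ih =>
    rw [CantorBendixson.iteratedDerivedSet_succ, ih, relDerivedSet_apply]
    have hher : IsHereditary {s | HasRk F α s} := fun s hs t hts => HasRk.subset hF hs hts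
    ext f
    simp only [Set.mem_inter_iff, mem_derivedSet]
    constructor
    · rintro ⟨hacc, hf⟩
      rw [cubeImage_eq] at hf
      obtain ⟨s, hs, rfl⟩ := hf
      rw [accPt_chi_iff hher] at hacc
      rw [cubeImage_eq]
      exact ⟨s, hasRk_add_one.2 ⟨HasRk.mem hs, by convert hacc; rfl⟩, rfl⟩
    · intro hf
      rw [cubeImage_eq] at hf
      obtain ⟨s, hs, rfl⟩ := hf
      refine ⟨?_, ?_⟩
      · rw [accPt_chi_iff hher]
        convert (hasRk_add_one.1 hs).2
        rfl
      · rw [cubeImage_eq]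
        exact ⟨s, HasRk.anti hs le_self_add, rfl⟩
  | limit α hα ih =>
    rw [CantorBendixson.iteratedDerivedSet_limit hα]
    ext f
    simp only [Set.mem_iInter]
    constructor
    · intro h
      have h0 := h ⟨0, by simpa using hα.bot_lt⟩
      rw [ih 0 (by simpa using hα.bot_lt), cubeImage_eq] at h0
      obtain ⟨s, -, rfl⟩ := h0
      rw [cubeImage_eq]
      refine ⟨s, (hasRk_limit hα).2 fun β hβ => ?_, rfl⟩
      have := h ⟨β, hβ⟩
      rw [ih β hβ, cubeImage_eq] at this
      obtain ⟨t, ht, hts⟩ := this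
      rwa [← chi_injective hts]
    · rintro h ⟨β, hβ⟩
      rw [cubeImage_eq] at h
      obtain ⟨s, hs, rfl⟩ := h
      rw [ih β hβ, cubeImage_eq]
      exact ⟨s, HasRk.anti hs (le_of_lt hβ), rfl⟩

/-- The rank of a nonempty compact hereditary family is the number of derivatives that the empty
set survives. -/
theorem le_rk_iff (hF : IsHereditary F) (hc : IsCompactFamily F) (h0 : ∅ ∈ F) :
    α ≤ rk F ↔ HasRk F α ∅ := by
  obtain ⟨r, hr⟩ := exists_hasRk_iff_le hF hc h0
  rw [hr]
  suffices h : rk F = r by rw [h]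
  have hne : ∀ β ≤ r, (CantorBendixson.iteratedDerivedSet (cubeImage F) β).Nonempty := by
    intro β hβ
    rw [iteratedDerivedSet_cubeImage hF, cubeImage_eq]
    exact ⟨_, ∅, (hr β).2 hβ, rfl⟩
  have hemp : ∀ β, r < β → CantorBendixson.iteratedDerivedSet (cubeImage F) β = ∅ := by
    intro β hβ
    rw [iteratedDerivedSet_cubeImage hF, cubeImage_eq, Set.image_eq_empty,
      Set.eq_empty_iff_forall_notMem]
    intro s hs
    exact hβ.not_ge ((hr β).1 (HasRk.subset hF hs (Finset.empty_subset s)))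
  have hcb : cbRank (cubeImage F) = r + 1 := by
    refine le_antisymm (csInf_le' ?_) (le_csInf ⟨r + 1, ?_⟩ fun β hβ => ?_)
    · change _ = _
      rw [hemp (r + 1) (lt_add_one r), hemp _ ((lt_add_one r).trans (lt_add_one _))]
    · change _ = _
      rw [hemp (r + 1) (lt_add_one r), hemp _ ((lt_add_one r).trans (lt_add_one _))]
    · by_contra! hlt
      have hβr : β ≤ r := Order.lt_add_one_iff.1 hlt
      have hfix : ∀ γ, β ≤ γ → CantorBendixson.iteratedDerivedSet (cubeImage F) γ =
          CantorBendixson.iteratedDerivedSet (cubeImage F) β := by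
        intro γ
        induction γ using Ordinal.limitRecOn with
        | zero =>
          intro h
          rw [nonpos_iff_eq_zero.1 h]
        | add_one γ ih =>
          intro h
          rcases h.eq_or_lt with h | h
          · rw [h]
          · have hβ' := hβ
            change _ = _ at hβ'
            rw [CantorBendixson.iteratedDerivedSet_succ] at hβ' ⊢
            rw [ih (Order.lt_add_one_iff.1 h), hβ']
        | limit γ hγ ih =>
          intro h
          rcases h.eq_or_lt with h | h
          · rw [h]
          · rw [CantorBendixson.iteratedDerivedSet_limit hγ]
            refine Set.Subset.antisymm (Set.iInter_subset _ (⟨β, h⟩ : Set.Iio γ)) ?_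
            refine Set.subset_iInter ?_
            rintro ⟨δ, hδ⟩
            rcases le_total β δ with hd | hd
            · exact (ih δ hδ hd).ge
            · exact CantorBendixson.iteratedDerivedSet_antitone _ hd
      have := hne β hβr
      rw [← hfix (r + 1) (hβr.trans le_self_add), hemp _ (lt_add_one r)] at this
      exact Set.not_nonempty_empty this
  rw [rk, hcb, Ordinal.pred_add_one]

theorem rk_lt_of_hasPotential (hF : IsHereditary F) (h0 : ∅ ∈ F) (h : HasPotential F l) :
    rk F < l := by
  have hc := isCompactFamily_of_hasPotential hF h
  obtain ⟨Φ, hΦ, hl⟩ := h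
  exact (((le_rk_iff hF hc h0).1 le_rfl).le_potential hΦ).trans_lt hl

theorem rk_mono (hF : IsHereditary F) (hFc : IsCompactFamily F) (h0 : ∅ ∈ F)
    (hG : IsHereditary G) (hGc : IsCompactFamily G) (h : F ⊆ G) : rk F ≤ rk G :=
  (le_rk_iff hG hGc (h h0)).2 (((le_rk_iff hF hFc h0).1 le_rfl).mono h)

end Families

/-! ### Rank and small rank of compact families -/

section Families

variable {I : Type u} {F G : Set (Finset I)} {α β l : Ordinal.{u}} {s t : Finset I}

/-- A compact hereditary family has a potential that is controlled by its rank. Adding a point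
either lowers the Cantor-Bendixson rank of the finite set, or the point belongs to the finite set
of exceptional points where the rank stays the same. -/
theorem hasPotential_of_isCompactFamily (hF : IsHereditary F) (hc : IsCompactFamily F)
    (h0 : ∅ ∈ F) : HasPotential F (ω * (rk F + 1)) := by
  classical
  have hex : ∀ s : Finset I, ∃ r : Ordinal.{u}, s ∈ F → ∀ α, HasRk F α s ↔ α ≤ r := fun s => by
    by_cases hs : s ∈ F
    · obtain ⟨r, hr⟩ := exists_hasRk_iff_le hF hc hs
      exact ⟨r, fun _ => hr⟩
    · exact ⟨0, fun h => absurd h hs⟩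
  choose r hr using hex
  have hfin : ∀ s ∈ F, {i | HasRk F (r s) (insert i s)}.Finite := fun s hs => by
    by_contra hinf
    exact (lt_add_one (r s)).not_ge ((hr s hs _).1 (hasRk_add_one.2 ⟨hs, hinf⟩))
  -- the number of exceptional points, which include the members of `s`
  let E : Finset I → ℕ := fun s => {i | HasRk F (r s) (insert i s)}.ncard
  let Φ : Finset I → Ordinal.{u} := fun s => ω * r s + ((E s - s.card : ℕ) : Ordinal.{u})
  have hlt : ∀ s, Φ s < ω * (r s + 1) := fun s => by
    rw [mul_add_one]
    exact (add_lt_add_iff_left _).2 (natCast_lt_omega0 _)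
  refine ⟨Φ, isPotential_of_insert hF fun s i his hi => ?_, ?_⟩
  · have hs : s ∈ F := hF _ hi _ (Finset.subset_insert _ _)
    have hle : r (insert i s) ≤ r s :=
      (hr s hs _).1 (((hr _ hi _).2 le_rfl).subset hF (Finset.subset_insert _ _))
    rcases hle.lt_or_eq with hlt' | heq
    · calc Φ (insert i s) < ω * (r (insert i s) + 1) := hlt _
        _ ≤ ω * r s := by
          gcongr
          exact Order.add_one_le_of_lt hlt'
        _ ≤ Φ s := le_self_add
    · have hsub : {j | HasRk F (r (insert i s)) (insert j (insert i s))} ⊆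
          {j | HasRk F (r s) (insert j s)} := fun j hj => by
        rw [heq] at hj
        exact HasRk.subset hF hj (Finset.insert_subset_insert _ (Finset.subset_insert _ _))
      have h1 : E (insert i s) ≤ E s := Set.ncard_le_ncard hsub (hfin s hs)
      have h2 : (insert i s).card ≤ E s := by
        rw [← Set.ncard_coe_finset]
        refine Set.ncard_le_ncard (fun j hj => ?_) (hfin s hs)
        have : HasRk F (r s) (insert i s) := (hr _ hi _).2 heq.ge
        exact HasRk.subset hF this
          (Finset.insert_subset (by simpa using hj) (Finset.subset_insert _ _))
      rw [Finset.card_insert_of_notMem his] at h2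
      change ω * r (insert i s) + _ < ω * r s + _
      rw [heq, add_lt_add_iff_left, Nat.cast_lt, Finset.card_insert_of_notMem his]
      omega
  · refine (hlt ∅).trans_le ?_
    have : r ∅ ≤ rk F := (le_rk_iff hF hc h0).2 ((hr ∅ h0 _).2 le_rfl)
    gcongr

theorem IsHereditary.empty_mem (hF : IsHereditary F) (hs : s ∈ F) : ∅ ∈ F :=
  hF s hs _ (Finset.empty_subset _)

theorem restrict_subset (A : Set I) : restrict F A ⊆ F := fun _ h => h.1

theorem IsHereditary.restrict (hF : IsHereditary F) (A : Set I) :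
    IsHereditary (restrict F A) :=
  fun s hs t hts => ⟨hF s hs.1 t hts, fun _ hi => hs.2 (hts hi)⟩

theorem IsCompactFamily.subset (hF : IsHereditary F) (hG : IsHereditary G)
    (hc : IsCompactFamily G) (h : F ⊆ G) : IsCompactFamily F := by
  obtain ⟨Φ, hΦ⟩ := exists_isPotential hG hc
  exact isCompactFamily_of_hasPotential hF
    ⟨Φ, fun s t ht => hΦ s t (h ht), lt_add_one _⟩

theorem IsCompactFamily.restrict (hF : IsHereditary F) (hc : IsCompactFamily F) (A : Set I) :
    IsCompactFamily (restrict F A) :=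
  hc.subset (hF.restrict A) hF (restrict_subset A)

theorem isHereditary_union (hF : IsHereditary F) (hG : IsHereditary G) : IsHereditary (F ∪ G) :=
  fun s hs t hts => hs.imp (fun h => hF s h t hts) fun h => hG s h t hts

end Families

section SmallRank

variable {P : Type u} [PartialOrder P] {F G : Set (Finset P)} {α : Ordinal.{u}}

theorem srk_le {C : Set P} (hC : C.Infinite) (hC' : IsCh C) : srk F ≤ rk (restrict F C) :=
  csInf_le' ⟨C, hC, hC', rfl⟩

theorem le_srk (hP : ∃ C : Set P, C.Infinite ∧ IsCh C)
    (h : ∀ C : Set P, C.Infinite → IsCh C → α ≤ rk (restrict F C)) : α ≤ srk F := by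
  obtain ⟨C, hC, hC'⟩ := hP
  refine le_csInf ⟨_, C, hC, hC', rfl⟩ ?_
  rintro _ ⟨D, hD, hD', rfl⟩
  exact h D hD hD'

theorem exists_srk_eq_rk (hP : ∃ C : Set P, C.Infinite ∧ IsCh C) (F : Set (Finset P)) :
    ∃ C : Set P, C.Infinite ∧ IsCh C ∧ srk F = rk (restrict F C) := by
  obtain ⟨C, hC, hC'⟩ := hP
  have : srk F ∈ {α | ∃ C : Set P, C.Infinite ∧ IsCh C ∧ α = rk (restrict F C)} :=
    csInf_mem ⟨_, C, hC, hC', rfl⟩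
  exact this

theorem srk_mono (hP : ∃ C : Set P, C.Infinite ∧ IsCh C) (hF : IsHereditary F) (h0 : ∅ ∈ F)
    (hG : IsHereditary G) (hGc : IsCompactFamily G) (h : F ⊆ G) : srk F ≤ srk G := by
  refine le_srk hP fun C hC hC' => (srk_le hC hC').trans ?_
  refine rk_mono (hF.restrict C) ((hGc.subset hF hG h).restrict hF C) ⟨h0, by simp⟩
    (hG.restrict C) (hGc.restrict hG C) ?_
  exact fun s hs => ⟨h hs.1, hs.2⟩

theorem srk_le_rk (hP : ∃ C : Set P, C.Infinite ∧ IsCh C) (hF : IsHereditary F)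
    (hc : IsCompactFamily F) (h0 : ∅ ∈ F) : srk F ≤ rk F := by
  obtain ⟨C, hC, hC'⟩ := hP
  exact (srk_le hC hC').trans (rk_mono (hF.restrict C) (hc.restrict hF C) ⟨h0, by simp⟩ hF hc
    (restrict_subset C))

theorem one_le_srk (hP : ∃ C : Set P, C.Infinite ∧ IsCh C) (hF : IsHereditary F)
    (hc : IsCompactFamily F) (h : cube P 1 ⊆ F) : 1 ≤ srk F := by
  classical
  refine le_srk hP fun C hC _ => ?_
  have h0 : ∅ ∈ F := h ⟨by simp [IsCh], by simp⟩
  rw [le_rk_iff (hF.restrict C) (hc.restrict hF C) ⟨h0, by simp⟩, ← zero_add 1, hasRk_add_one]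
  refine ⟨⟨h0, by simp⟩, hC.mono fun i hi => hasRk_zero.2 ⟨h ⟨?_, ?_⟩, ?_⟩⟩
  · simp [IsCh]
  · simp
  · simpa using hi

theorem cube_hereditary (n : ℕ) : IsHereditary (cube P n) := fun _ hs _ hts =>
  ⟨hs.1.mono (by simpa using hts), (Finset.card_le_card hts).trans hs.2⟩

theorem hasPotential_cube (n : ℕ) : HasPotential (cube P n) ω := by
  refine ⟨fun s => ((n - s.card : ℕ) : Ordinal.{u}), fun s t ht hst => ?_, natCast_lt_omega0 _⟩
  have := Finset.card_lt_card hst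
  have := ht.2
  rw [Nat.cast_lt]
  omega

theorem empty_mem_cube (n : ℕ) : ∅ ∈ cube P n := ⟨by simp [IsCh], by simp⟩

theorem cube_mono {m n : ℕ} (h : m ≤ n) : cube P m ⊆ cube P n :=
  fun _ hs => ⟨hs.1, hs.2.trans h⟩

theorem cube_zero : cube P 0 = {∅} := by
  ext s
  constructor
  · intro h
    simpa using h.2
  · rintro rfl
    exact empty_mem_cube 0

theorem srk_lt_of_hasPotential {l : Ordinal.{u}} (hP : ∃ C : Set P, C.Infinite ∧ IsCh C)
    (hF : IsHereditary F) (h0 : ∅ ∈ F) (h : HasPotential F l) : srk F < l :=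
  (srk_le_rk hP hF (isCompactFamily_of_hasPotential hF h) h0).trans_lt
    (rk_lt_of_hasPotential hF h0 h)

theorem srk_singleton_empty (hP : ∃ C : Set P, C.Infinite ∧ IsCh C) :
    srk ({∅} : Set (Finset P)) = 0 := by
  have hher : IsHereditary ({∅} : Set (Finset P)) := by
    rw [← cube_zero]
    exact cube_hereditary 0
  have : srk ({∅} : Set (Finset P)) < 1 := by
    refine srk_lt_of_hasPotential hP hher rfl ⟨fun _ => 0, fun s t ht hst => ?_, zero_lt_one⟩
    rw [Set.mem_singleton_iff.1 ht] at hst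
    exact absurd hst (Finset.not_ssubset_empty s)
  simpa using this

theorem mem_chainSup [DecidableEq P] {u : Finset P} : u ∈ chainSup F G ↔
    IsCh (u : Set P) ∧ ∃ s ∈ F, ∃ t ∈ G, u = s ∪ t := by
  refine and_congr_right fun _ => ?_
  simp only [← Finset.coe_union, Finset.coe_inj]

theorem isHereditary_chainSup (hF : IsHereditary F) (hG : IsHereditary G) :
    IsHereditary (chainSup F G) := by
  classical
  intro u hu v hvu
  rw [mem_chainSup] at hu ⊢
  obtain ⟨hch, s, hs, t, ht, rfl⟩ := hu
  refine ⟨hch.mono (Finset.coe_subset.2 hvu), v ∩ s, hF _ hs _ Finset.inter_subset_right,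
    v ∩ t, hG _ ht _ Finset.inter_subset_right, ?_⟩
  rw [← Finset.inter_union_distrib_left, Finset.inter_eq_left.2 hvu]

end SmallRank

/-! ### Ordinal arithmetic -/

/-- The natural sum of `a` and `ω ^ e`: if `a = ω ^ e * q + r` with `r < ω ^ e`, then the new term
is inserted before `r` and so raises the quotient `q` by one. -/
noncomputable def natAdd (e a : Ordinal.{u}) : Ordinal.{u} := ω ^ e * (a / ω ^ e + 1) + a % ω ^ e

section Arithmetic

variable {a b c e f : Ordinal.{u}}

theorem omega0_opow_ne_zero (e : Ordinal.{u}) : (ω : Ordinal.{u}) ^ e ≠ 0 :=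
  (opow_pos e omega0_pos).ne'

theorem natAdd_mul_add {q r : Ordinal.{u}} (hr : r < ω ^ e) :
    natAdd e (ω ^ e * q + r) = ω ^ e * (q + 1) + r := by
  rw [natAdd, mul_add_div _ (omega0_opow_ne_zero e), div_eq_zero_of_lt hr, add_zero,
    mul_add_mod_self, mod_eq_of_lt hr]

theorem exists_mul_add (e a : Ordinal.{u}) : ∃ q r : Ordinal.{u}, r < ω ^ e ∧ a = ω ^ e * q + r :=
  ⟨a / ω ^ e, a % ω ^ e, mod_lt _ (omega0_opow_ne_zero e), (div_add_mod _ _).symm⟩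

theorem natAdd_zero (e : Ordinal.{u}) : natAdd e 0 = ω ^ e := by
  have := natAdd_mul_add (e := e) (q := 0) (r := 0) (opow_pos e omega0_pos)
  simpa using this

theorem mul_add_lt_mul_add_iff {q r q' r' : Ordinal.{u}} (hr : r < ω ^ e) (hr' : r' < ω ^ e) :
    ω ^ e * q + r < ω ^ e * q' + r' ↔ q < q' ∨ q = q' ∧ r < r' := by
  have key : ∀ {q r q' r' : Ordinal.{u}}, r < ω ^ e → q < q' →
      ω ^ e * q + r < ω ^ e * q' + r' := fun {q r q' r'} hr h =>
    calc ω ^ e * q + r < ω ^ e * q + ω ^ e := (add_lt_add_iff_left _).2 hr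
      _ = ω ^ e * (q + 1) := (mul_add_one _ _).symm
      _ ≤ ω ^ e * q' := by
        gcongr
        exact Order.add_one_le_of_lt h
      _ ≤ _ := le_self_add
  constructor
  · intro h
    rcases lt_trichotomy q q' with h1 | h1 | h1
    · exact Or.inl h1
    · refine Or.inr ⟨h1, ?_⟩
      rw [h1] at h
      exact (add_lt_add_iff_left _).1 h
    · exact absurd h (key hr' h1).asymm
  · rintro (h | ⟨rfl, h⟩)
    · exact key hr h
    · exact (add_lt_add_iff_left _).2 h

theorem natAdd_strictMono (e : Ordinal.{u}) : StrictMono (natAdd e) := by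
  intro a b h
  obtain ⟨q, r, hr, rfl⟩ := exists_mul_add e a
  obtain ⟨q', r', hr', rfl⟩ := exists_mul_add e b
  rw [natAdd_mul_add hr, natAdd_mul_add hr']
  rw [mul_add_lt_mul_add_iff hr hr'] at h ⊢
  rcases h with h | ⟨h, h'⟩
  · exact Or.inl (by simpa using h)
  · exact Or.inr ⟨by rw [h], h'⟩

theorem opow_mul_eq_of_lt (h : f < e) (q : Ordinal.{u}) :
    ω ^ e * q = ω ^ f * (ω ^ (e - f) * q) := by
  rw [← mul_assoc, ← opow_add, Ordinal.add_sub_cancel_of_le h.le]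

theorem natAdd_mul_add_of_lt {q r : Ordinal.{u}} (h : f < e) :
    natAdd f (ω ^ e * q + r) = ω ^ e * q + natAdd f r := by
  obtain ⟨q', r', hr', rfl⟩ := exists_mul_add f r
  rw [natAdd_mul_add hr', opow_mul_eq_of_lt h, ← add_assoc, ← mul_add, natAdd_mul_add hr',
    ← add_assoc, ← mul_add, add_assoc]

theorem natAdd_lt_opow (h : f < e) (ha : a < ω ^ e) : natAdd f a < ω ^ e := by
  obtain ⟨q, r, hr, rfl⟩ := exists_mul_add f a
  rw [natAdd_mul_add hr]
  have h1 : ω ^ f * q < ω ^ e := le_self_add.trans_lt ha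
  have h2 : (ω : Ordinal.{u}) ^ f < ω ^ e := (opow_lt_opow_iff_right one_lt_omega0).2 h
  have hp := isPrincipal_add_omega0_opow e
  refine hp ?_ (hr.trans h2)
  rw [mul_add_one]
  exact hp h1 h2

theorem natAdd_comm (e f a : Ordinal.{u}) : natAdd e (natAdd f a) = natAdd f (natAdd e a) := by
  wlog h : f < e generalizing e f
  · rcases (not_lt.1 h).eq_or_lt with rfl | h'
    · rfl
    · exact (this f e h').symm
  obtain ⟨q, r, hr, rfl⟩ := exists_mul_add e a
  rw [natAdd_mul_add_of_lt h, natAdd_mul_add (natAdd_lt_opow h hr), natAdd_mul_add hr,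
    natAdd_mul_add_of_lt h]

/-- Two powers of `ω` with smaller exponents add less than one power of `ω`. -/
theorem natAdd_natAdd_lt {e' f' : Ordinal.{u}} (he : e' < e) (hf : f' < e) (a : Ordinal.{u}) :
    natAdd f' (natAdd e' a) < natAdd e a := by
  obtain ⟨q, r, hr, rfl⟩ := exists_mul_add e a
  have h1 := natAdd_lt_opow he hr
  rw [natAdd_mul_add_of_lt he, natAdd_mul_add_of_lt hf, natAdd_mul_add hr,
    mul_add_lt_mul_add_iff (natAdd_lt_opow hf h1) hr]
  exact Or.inl (lt_add_one q)

theorem natAdd_lt_natAdd (h : f < e) (a : Ordinal.{u}) : natAdd f a < natAdd e a := by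
  obtain ⟨q, r, hr, rfl⟩ := exists_mul_add e a
  rw [natAdd_mul_add_of_lt h, natAdd_mul_add hr,
    mul_add_lt_mul_add_iff (natAdd_lt_opow h hr) hr]
  exact Or.inl (lt_add_one q)

theorem natAdd_le_natAdd (h : f ≤ e) (hab : a ≤ b) : natAdd f a ≤ natAdd e b := by
  refine ((natAdd_strictMono f).monotone hab).trans ?_
  rcases h.eq_or_lt with rfl | h
  · exact le_rfl
  · exact (natAdd_lt_natAdd h b).le

theorem ExpIndecomposable.mul_lt (hl : ExpIndecomposable c) (ha : a < c) (hb : b < c) :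
    a * b < c := by
  have h2 : (2 : Ordinal.{u}) < c := lt_of_lt_of_le (by exact_mod_cast natCast_lt_omega0 2) hl.1
  have hm : max a b < c := max_lt ha hb
  refine lt_of_le_of_lt ?_ (hl.2 _ hm 2 h2)
  rw [show (2 : Ordinal.{u}) = 1 + 1 from one_add_one_eq_two.symm, opow_add, opow_one]
  exact mul_le_mul' (le_max_left a b) (le_max_right a b)

theorem ExpIndecomposable.add_one_lt (hl : ExpIndecomposable c) (ha : a < c) : a + 1 < c := by
  rcases lt_or_ge a ω with h | h
  · exact lt_of_lt_of_le (isSuccLimit_omega0.add_one_lt h) hl.1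
  · have h2 : (2 : Ordinal.{u}) < c :=
      lt_of_lt_of_le (by exact_mod_cast natCast_lt_omega0 2) hl.1
    refine lt_of_le_of_lt ?_ (hl.mul_lt ha h2)
    rw [← one_add_one_eq_two, mul_add_one, mul_one]
    gcongr
    exact (one_lt_omega0.trans_le h).le

theorem ExpIndecomposable.add_lt (hl : ExpIndecomposable c) (ha : a < c) (hb : b < c) :
    a + b < c := by
  have h2 : (2 : Ordinal.{u}) < c := lt_of_lt_of_le (by exact_mod_cast natCast_lt_omega0 2) hl.1
  refine lt_of_le_of_lt ?_ (hl.mul_lt (max_lt ha hb) h2)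
  rw [← one_add_one_eq_two, mul_add_one, mul_one]
  exact add_le_add (le_max_left a b) (le_max_right a b)

theorem expIndecomposable_omega0 : ExpIndecomposable (ω : Ordinal.{u}) :=
  ⟨le_rfl, fun _ hβ _ hγ => isPrincipal_opow_omega0 hβ hγ⟩

/-- There are exp-indecomposable ordinals above every ordinal, and countable ones above every
countable ordinal: iterate `x ↦ x ^ x`. -/
theorem exists_expIndecomposable (a : Ordinal.{u}) :
    ∃ c, a < c ∧ ExpIndecomposable c ∧ (a < ω₁ → c < ω₁) := by
  let g : ℕ → Ordinal.{u} := fun n => Nat.rec (max a ω + 1) (fun _ x => x ^ x) n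
  have hg0 : g 0 = max a ω + 1 := rfl
  have hg1 : ∀ n, g (n + 1) = g n ^ g n := fun n => rfl
  have hω : ∀ n, ω < g n := by
    intro n
    induction n with
    | zero => rw [hg0]; exact (le_max_right a ω).trans_lt (lt_add_one _)
    | succ n ih => rw [hg1]; exact ih.trans_le (left_le_opow _ (omega0_pos.trans ih))
  have hlt : ∀ n, g n < g (n + 1) := by
    intro n
    have h1 : 1 < g n := one_lt_omega0.trans (hω n)
    rw [hg1]
    conv_lhs => rw [← opow_one (g n)]
    exact (opow_lt_opow_iff_right h1).2 h1
  have hmono : StrictMono g := strictMono_nat_of_lt_succ hlt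
  have hsup : ∀ n, g n < ⨆ n, g n := fun n =>
    (hlt n).trans_le (Ordinal.le_iSup g (n + 1))
  refine ⟨⨆ n, g n, ?_, ⟨((hω 0).trans (hsup 0)).le, fun β hβ γ hγ => ?_⟩, fun ha => ?_⟩
  · refine lt_trans ?_ (hsup 0)
    rw [hg0]
    exact (le_max_left a ω).trans_lt (lt_add_one _)
  · obtain ⟨m, hm⟩ := Ordinal.lt_iSup_iff.1 hβ
    obtain ⟨n, hn⟩ := Ordinal.lt_iSup_iff.1 hγ
    refine lt_of_le_of_lt ?_ (hsup (max m n + 1))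
    rw [hg1]
    have h1 : β ≤ g (max m n) := hm.le.trans (hmono.monotone (le_max_left m n))
    have h2 : γ ≤ g (max m n) := hn.le.trans (hmono.monotone (le_max_right m n))
    exact (opow_le_opow_left γ h1).trans (opow_le_opow_right (omega0_pos.trans (hω _)) h2)
  · refine Ordinal.iSup_lt_omega_one fun n => ?_
    have hω₁ : (ω : Ordinal.{u}) < ω₁ := omega0_lt_omega_one
    induction n with
    | zero => rw [hg0]; exact (isSuccLimit_omega 1).add_one_lt (max_lt ha hω₁)
    | succ n ih => rw [hg1]; exact isPrincipal_opow_omega 1 ih ih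

theorem iota_mem (a : Ordinal.{u}) : a < iota a ∧ ExpIndecomposable (iota a) := by
  obtain ⟨c, hc, hc', -⟩ := exists_expIndecomposable a
  have : iota a ∈ {l | a < l ∧ ExpIndecomposable l} := csInf_mem ⟨c, hc, hc'⟩
  exact this

theorem lt_iota (a : Ordinal.{u}) : a < iota a := (iota_mem a).1

theorem expIndecomposable_iota (a : Ordinal.{u}) : ExpIndecomposable (iota a) := (iota_mem a).2

theorem iota_le (h : a < c) (hc : ExpIndecomposable c) : iota a ≤ c := csInf_le' ⟨h, hc⟩

theorem iota_lt_omega_one (h : a < ω₁) : iota a < ω₁ := by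
  obtain ⟨c, hc, hc', hc''⟩ := exists_expIndecomposable a
  exact (iota_le hc hc').trans_lt (hc'' h)

theorem iota_mono (h : a ≤ b) : iota a ≤ iota b :=
  iota_le (h.trans_lt (lt_iota b)) (expIndecomposable_iota b)

theorem omega0_le_iota (a : Ordinal.{u}) : ω ≤ iota a := (expIndecomposable_iota a).1

theorem iota_of_lt_omega0 (h : a < ω) : iota a = ω :=
  (iota_le h expIndecomposable_omega0).antisymm (omega0_le_iota a)

theorem omega0_le_of_lt_iota (h : ω < iota a) : ω ≤ a := by
  by_contra! h'
  exact h.ne' (iota_of_lt_omega0 h')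

theorem omega0_lt_iota (h : ω ≤ a) : ω < iota a := h.trans_lt (lt_iota a)

theorem expIndecomposable_max (ha : ExpIndecomposable a) (hb : ExpIndecomposable b) :
    ExpIndecomposable (max a b) := by
  rcases le_total a b with h | h <;> simpa [h]

theorem iota_mul (ha : 1 ≤ a) (hb : 1 ≤ b) : iota (a * b) = max (iota a) (iota b) := by
  refine le_antisymm (iota_le ?_ ?_) (max_le (iota_mono ?_) (iota_mono ?_))
  · exact (expIndecomposable_max (expIndecomposable_iota a) (expIndecomposable_iota b)).mul_lt
      (lt_max_of_lt_left (lt_iota a)) (lt_max_of_lt_right (lt_iota b))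
  · exact expIndecomposable_max (expIndecomposable_iota a) (expIndecomposable_iota b)
  · exact le_mul_of_one_le_right' hb
  · exact le_mul_of_one_le_left' ha

end Arithmetic

/-! ### Homogeneous families on total orders -/

section Homogeneous

variable {P : Type u} [PartialOrder P] {F G E : Set (Finset P)} {l : Ordinal.{u}}

/-- A potential of `F ⊔_P G`: the largest natural sum of the (exponentiated) potentials of `s` and
`t` over all decompositions `u = s ∪ t`. -/
theorem hasPotential_chainSup (hF : IsHereditary F) (hG : IsHereditary G)
    (hl : ExpIndecomposable l) (hω : ω < l) (hpF : HasPotential F l) (hpG : HasPotential G l) :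
    HasPotential (chainSup F G) l := by
  classical
  obtain ⟨Φ, hΦ, hΦl⟩ := hpF
  obtain ⟨Ψ, hΨ, hΨl⟩ := hpG
  let N : Finset P × Finset P → Ordinal.{u} := fun p => natAdd (Φ p.1) (natAdd (Ψ p.2) 0)
  let D : Finset P → Finset (Finset P × Finset P) := fun u =>
    (u.powerset ×ˢ u.powerset).filter fun p => p.1 ∈ F ∧ p.2 ∈ G ∧ u = p.1 ∪ p.2
  refine ⟨fun u => (D u).sup N, fun u v hv huv => ?_, ?_⟩
  · have hdec : ∀ s ∈ F, ∀ t ∈ G, v = s ∪ t → N (s, t) < (D u).sup N := by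
      rintro s hs t ht rfl
      have hsu : u ∩ s ∈ F := hF _ hs _ Finset.inter_subset_right
      have htu : u ∩ t ∈ G := hG _ ht _ Finset.inter_subset_right
      have hu : u = u ∩ s ∪ u ∩ t := by
        rw [← Finset.inter_union_distrib_left, Finset.inter_eq_left.2 huv.1]
      have hmem : (u ∩ s, u ∩ t) ∈ D u := by
        simp only [D, Finset.mem_filter, Finset.mem_product, Finset.mem_powerset]
        exact ⟨⟨Finset.inter_subset_left, Finset.inter_subset_left⟩, hsu, htu, hu⟩
      refine lt_of_lt_of_le ?_ (Finset.le_sup (f := N) hmem)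
      have hs1 := hΦ.le_of_subset hs (Finset.inter_subset_right (s₁ := u))
      have ht1 := hΨ.le_of_subset ht (Finset.inter_subset_right (s₁ := u))
      by_cases h : u ∩ s = s
      · have h' : u ∩ t ⊂ t := by
          refine Finset.inter_subset_right.ssubset_of_ne fun h' => huv.ne ?_
          rw [hu, h, h']
        refine (natAdd_strictMono _ ?_).trans_le (natAdd_le_natAdd hs1 le_rfl)
        exact natAdd_lt_natAdd (hΨ _ _ ht h') 0
      · have h' : u ∩ s ⊂ s := Finset.inter_subset_right.ssubset_of_ne h
        exact (natAdd_lt_natAdd (hΦ _ _ hs h') _).trans_le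
          (natAdd_le_natAdd le_rfl (natAdd_le_natAdd ht1 le_rfl))
    obtain ⟨-, s, hs, t, ht, hst⟩ := mem_chainSup.1 hv
    rw [Finset.sup_lt_iff (lt_of_le_of_lt bot_le (hdec s hs t ht hst))]
    rintro ⟨s', t'⟩ hp
    simp only [D, Finset.mem_filter] at hp
    exact hdec s' hp.2.1 t' hp.2.2.1 hp.2.2.2
  · have hm : max (Φ ∅) (Ψ ∅) + 1 < l := hl.add_one_lt (max_lt hΦl hΨl)
    refine lt_of_le_of_lt (b := natAdd (Φ ∅) (natAdd (Ψ ∅) 0)) ?_ (lt_trans ?_ (hl.2 _ hω _ hm))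
    · rw [Finset.sup_le_iff]
      rintro ⟨s, t⟩ hp
      simp only [D, Finset.mem_filter, Finset.mem_product, Finset.mem_powerset,
        Finset.subset_empty] at hp
      rw [hp.1.1, hp.1.2]
    · refine natAdd_lt_opow (Order.lt_add_one_iff.2 (le_max_left _ _)) ?_
      refine natAdd_lt_opow (Order.lt_add_one_iff.2 (le_max_right _ _)) ?_
      exact opow_pos _ omega0_pos

theorem rk_singleton_empty : rk ({∅} : Set (Finset P)) = 0 := by
  have : rk ({∅} : Set (Finset P)) < 1 := by
    refine rk_lt_of_hasPotential (I := P) ?_ rfl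
      ⟨fun _ => 0, fun s t ht hst => ?_, zero_lt_one⟩
    · rw [← cube_zero]
      exact cube_hereditary 0
    · rw [Set.mem_singleton_iff.1 ht] at hst
      exact absurd hst (Finset.not_ssubset_empty s)
  simpa using this

section Total

variable (htot : ∀ A : Set P, IsCh A)
include htot

theorem subset_chainSup_left (h0 : ∅ ∈ G) : F ⊆ chainSup F G := by
  classical
  exact fun s hs => mem_chainSup.2 ⟨htot _, s, hs, ∅, h0, by simp⟩

theorem subset_chainSup_right (h0 : ∅ ∈ F) : G ⊆ chainSup F G := by
  classical
  exact fun s hs => mem_chainSup.2 ⟨htot _, ∅, h0, s, hs, by simp⟩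

variable [Infinite P]

theorem exists_infinite_ch : ∃ C : Set P, C.Infinite ∧ IsCh C :=
  ⟨Set.univ, Set.infinite_univ, htot _⟩

theorem isHomogeneous_iff : IsHomogeneous F ↔ IsHereditary F ∧ IsCompactFamily F ∧
    (F = {∅} ∨ cube P 1 ⊆ F ∧ srk F < ω₁ ∧ rk F < iota (srk F)) := by
  constructor
  · rintro ⟨α, -, hc, hF, hα, h0, h1⟩
    refine ⟨hF, hc, ?_⟩
    rcases eq_or_ne α 0 with h | h
    · exact Or.inl (h0 h)
    · obtain ⟨h2, h3, h4, h5⟩ := h1 (Order.one_le_iff_pos.2 (pos_iff_ne_zero.2 h))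
      subst h3
      exact Or.inr ⟨h2, hα, h5⟩
  · rintro ⟨hF, hc, rfl | ⟨h1, h2, h3⟩⟩
    · exact ⟨0, fun s _ => htot _, hc, hF, omega_pos 1, fun _ => rfl,
        fun h => absurd h (not_le.2 zero_lt_one)⟩
    · have hP := exists_infinite_ch htot
      have hs := one_le_srk hP hF hc h1
      exact ⟨srk F, fun s _ => htot _, hc, hF, h2, fun h => absurd hs (by rw [h]; simp),
        fun _ => ⟨h1, rfl, srk_le_rk hP hF hc (h1 (empty_mem_cube 1)), h3⟩⟩

theorem IsHomogeneous.isHereditary (h : IsHomogeneous F) : IsHereditary F :=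
  ((isHomogeneous_iff htot).1 h).1

theorem IsHomogeneous.isCompactFamily (h : IsHomogeneous F) : IsCompactFamily F :=
  ((isHomogeneous_iff htot).1 h).2.1

theorem IsHomogeneous.empty_mem (h : IsHomogeneous F) : ∅ ∈ F := by
  obtain ⟨-, -, rfl | ⟨h, -⟩⟩ := (isHomogeneous_iff htot).1 h
  · rfl
  · exact h (empty_mem_cube 1)

theorem IsHomogeneous.srk_lt_omega_one (h : IsHomogeneous F) : srk F < ω₁ := by
  obtain ⟨-, -, rfl | ⟨-, h, -⟩⟩ := (isHomogeneous_iff htot).1 h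
  · rw [srk_singleton_empty (exists_infinite_ch htot)]
    exact omega_pos 1
  · exact h

theorem IsHomogeneous.eq_or_one_le (h : IsHomogeneous F) : F = {∅} ∨ 1 ≤ srk F := by
  obtain ⟨hF, hc, h | ⟨h, -⟩⟩ := (isHomogeneous_iff htot).1 h
  · exact Or.inl h
  · exact Or.inr (one_le_srk (exists_infinite_ch htot) hF hc h)

theorem IsHomogeneous.cube_subset (h : IsHomogeneous F) (h1 : 1 ≤ srk F) : cube P 1 ⊆ F := by
  obtain ⟨-, -, rfl | ⟨h, -⟩⟩ := (isHomogeneous_iff htot).1 h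
  · rw [srk_singleton_empty (exists_infinite_ch htot)] at h1
    exact absurd h1 (by simp)
  · exact h

theorem IsHomogeneous.rk_lt_iota (h : IsHomogeneous F) : rk F < iota (srk F) := by
  obtain ⟨-, -, rfl | ⟨-, -, h⟩⟩ := (isHomogeneous_iff htot).1 h
  · rw [rk_singleton_empty]
    exact omega0_pos.trans_le (omega0_le_iota _)
  · exact h

theorem IsHomogeneous.hasPotential (h : IsHomogeneous F) (hl : ExpIndecomposable l) (hω : ω < l)
    (hFl : iota (srk F) ≤ l) : HasPotential F l := by
  have h1 := hasPotential_of_isCompactFamily (h.isHereditary htot) (h.isCompactFamily htot)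
    (h.empty_mem htot)
  exact h1.mono (hl.mul_lt hω (hl.add_one_lt ((h.rk_lt_iota htot).trans_le hFl))).le

/-- A hereditary family is homogeneous as soon as it has a potential below some `ι (srk F)` where
`F` is a homogeneous subfamily. -/
theorem isHomogeneous_of_hasPotential (hF : IsHomogeneous F) (hE : IsHereditary E) (hFE : F ⊆ E)
    (hp : HasPotential E (iota (srk F))) (h0 : F = {∅} → E = {∅}) :
    IsHomogeneous E ∧ iota (srk E) = iota (srk F) := by
  have hP := exists_infinite_ch htot
  have hc := isCompactFamily_of_hasPotential hE hp
  have h0E : ∅ ∈ E := hFE (hF.empty_mem htot)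
  have hlt : srk E < iota (srk F) := srk_lt_of_hasPotential hP hE h0E hp
  have hle : srk F ≤ srk E := srk_mono hP (hF.isHereditary htot) (hF.empty_mem htot) hE hc hFE
  have heq : iota (srk E) = iota (srk F) :=
    (iota_le hlt (expIndecomposable_iota _)).antisymm (iota_mono hle)
  refine ⟨(isHomogeneous_iff htot).2 ⟨hE, hc, ?_⟩, heq⟩
  obtain ⟨-, -, h | ⟨h, -⟩⟩ := (isHomogeneous_iff htot).1 hF
  · exact Or.inl (h0 h)
  · refine Or.inr ⟨h.trans hFE, ?_, ?_⟩
    · exact hlt.trans (iota_lt_omega_one (hF.srk_lt_omega_one htot))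
    · rw [heq]
      exact rk_lt_of_hasPotential hE h0E hp

/-- A hereditary family that contains two homogeneous families and has a potential below the larger
of their values of `ι` is homogeneous with that value. -/
theorem isHomogeneous_of_subset_of_subset (hF : IsHomogeneous F) (hG : IsHomogeneous G)
    (hE : IsHereditary E) (hFE : F ⊆ E) (hGE : G ⊆ E)
    (hp : HasPotential E (max (iota (srk F)) (iota (srk G))))
    (h0 : F = {∅} → G = {∅} → E = {∅}) :
    IsHomogeneous E ∧ iota (srk E) = max (iota (srk F)) (iota (srk G)) := by
  have hP := exists_infinite_ch htot
  wlog h : srk F ≤ srk G generalizing F G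
  · rw [max_comm] at hp ⊢
    exact this hG hF hGE hFE hp (fun h1 h2 => h0 h2 h1) (not_le.1 h).le
  rw [max_eq_right (iota_mono h)] at hp ⊢
  refine isHomogeneous_of_hasPotential htot hG hE hGE hp fun hG0 => h0 ?_ hG0
  refine (hF.eq_or_one_le htot).resolve_right fun h1 => ?_
  rw [hG0, srk_singleton_empty hP] at h
  exact absurd (h1.trans h) (by simp)

theorem isHomogeneous_chainSup (hF : IsHomogeneous F) (hG : IsHomogeneous G)
    (h : ω < max (iota (srk F)) (iota (srk G))) : IsHomogeneous (chainSup F G) ∧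
    iota (srk (chainSup F G)) = max (iota (srk F)) (iota (srk G)) := by
  classical
  have hl := expIndecomposable_max (expIndecomposable_iota (srk F)) (expIndecomposable_iota (srk G))
  refine isHomogeneous_of_subset_of_subset htot hF hG
    (isHereditary_chainSup (hF.isHereditary htot) (hG.isHereditary htot))
    (subset_chainSup_left htot (hG.empty_mem htot))
    (subset_chainSup_right htot (hF.empty_mem htot))
    (hasPotential_chainSup (hF.isHereditary htot) (hG.isHereditary htot) hl h
      (hF.hasPotential htot hl h (le_max_left _ _))
      (hG.hasPotential htot hl h (le_max_right _ _))) ?_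
  rintro rfl rfl
  ext u
  rw [mem_chainSup]
  simp [htot]

theorem isHomogeneous_cube (n : ℕ) : IsHomogeneous (cube P n) := by
  have hP := exists_infinite_ch htot
  have hc := isCompactFamily_of_hasPotential (cube_hereditary n) (hasPotential_cube (P := P) n)
  refine (isHomogeneous_iff htot).2 ⟨cube_hereditary n, hc, ?_⟩
  rcases Nat.eq_zero_or_pos n with rfl | hn
  · exact Or.inl cube_zero
  · have h := srk_lt_of_hasPotential hP (cube_hereditary n) (empty_mem_cube n)
      (hasPotential_cube (P := P) n)
    refine Or.inr ⟨cube_mono hn, h.trans omega0_lt_omega_one, ?_⟩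
    rw [iota_of_lt_omega0 h]
    exact rk_lt_of_hasPotential (cube_hereditary n) (empty_mem_cube n) (hasPotential_cube n)

theorem srk_lt_omega0_of_subset_cube (hF : IsHomogeneous F) {n : ℕ} (h : F ⊆ cube P n) :
    srk F < ω :=
  srk_lt_of_hasPotential (exists_infinite_ch htot) (hF.isHereditary htot) (hF.empty_mem htot)
    ((hasPotential_cube n).subset h)

end Total

end Homogeneous

/-! ### The full binary tree and the families induced on its branches -/

/-- The properties of the first difference `Δ x y` of two branches `x`, `y` of the full binary
tree of height `Q`, where `Δ x x = ⊤`: it is an ultrametric with values in `WithTop Q` in which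
at most two directions leave every node, pairwise compatible nodes lie on a common branch, and
every increasing sequence of levels is realised by a comb. -/
structure IsFirstDifference {P Q : Type u} [LinearOrder Q] (Δ : P → P → WithTop Q) : Prop where
  eq_top_iff : ∀ x y, Δ x y = ⊤ ↔ x = y
  comm : ∀ x y, Δ x y = Δ y x
  trans : ∀ γ x y z, γ ≤ Δ x y → γ ≤ Δ y z → γ ≤ Δ x z
  binary : ∀ (i : Q) x y z, Δ x y = i → Δ x z = i → i < Δ y z
  complete : ∀ C : Set (P × WithTop Q), (∀ a ∈ C, ∀ b ∈ C, min a.2 b.2 ≤ Δ a.1 b.1) →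
    ∃ p, ∀ a ∈ C, a.2 ≤ Δ a.1 p
  comb : ∀ c : ℕ → Q, StrictMono c → ∃ x : ℕ → P, ∀ m n, m < n → Δ (x m) (x n) = c m

open scoped Classical in
/-- The levels at which the elements of `s` branch off from `x`. -/
noncomputable def splits {P Q : Type u} (Δ : P → P → WithTop Q) (x : P) (s : Finset P) :
    Finset Q :=
  (s.image (Δ x)).preimage (fun i : Q => (i : WithTop Q)) WithTop.coe_injective.injOn

/-- The family of all finite sets `s` of branches such that the branching levels along every
branch in `s` form a member of `K`. -/
def treeFamily {P Q : Type u} (Δ : P → P → WithTop Q) (K : Set (Finset Q)) : Set (Finset P) :=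
  {s | ∀ x ∈ s, splits Δ x s ∈ K}

section Tree

variable {P Q : Type u} {Δ : P → P → WithTop Q} {K L : Set (Finset Q)} {x y z : P} {i : Q}
  {s t : Finset P}

theorem mem_splits : i ∈ splits Δ x s ↔ ∃ y ∈ s, Δ x y = i := by
  classical
  simp [splits]

theorem splits_mono (h : s ⊆ t) : splits Δ x s ⊆ splits Δ x t := fun i hi => by
  obtain ⟨y, hy, hxy⟩ := mem_splits.1 hi
  exact mem_splits.2 ⟨y, h hy, hxy⟩

theorem isHereditary_treeFamily (hK : IsHereditary K) : IsHereditary (treeFamily Δ K) :=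
  fun _ hs _ hts x hx => hK _ (hs x (hts hx)) _ (splits_mono hts)

theorem treeFamily_mono (h : K ⊆ L) : treeFamily Δ K ⊆ treeFamily Δ L :=
  fun _ hs x hx => h (hs x hx)

variable [LinearOrder Q]

/-- A branch outside a nonempty list (read from right to left) branches off last from some member
`x` of the list; if `x` is the earliest such member, it branches off strictly above all the
points where the members before `x` do. -/
theorem exists_nearest (y : P) (l : List P) (hl : l ≠ []) : ∃ l₁ x l₂, l = l₁ ++ x :: l₂ ∧
    (∀ z ∈ l, Δ y z ≤ Δ y x) ∧ ∀ z ∈ l₂, Δ y z < Δ y x := by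
  induction l with
  | nil => exact absurd rfl hl
  | cons z l ih =>
    rcases eq_or_ne l [] with rfl | hne
    · exact ⟨[], z, [], rfl, by simp, by simp⟩
    · obtain ⟨l₁, x, l₂, rfl, h1, h2⟩ := ih hne
      rcases lt_or_ge (Δ y x) (Δ y z) with h | h
      · refine ⟨[], z, l₁ ++ x :: l₂, rfl, fun w hw => ?_, fun w hw => (h1 w hw).trans_lt h⟩
        rcases List.mem_cons.1 hw with rfl | hw
        · exact le_rfl
        · exact (h1 w hw).trans h.le
      · refine ⟨z :: l₁, x, l₂, rfl, fun w hw => ?_, h2⟩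
        rcases List.mem_cons.1 hw with rfl | hw
        · exact h
        · exact h1 w hw

variable (hΔ : IsFirstDifference Δ)
include hΔ

/-- The isosceles property of the ultrametric `Δ`. -/
theorem firstDifference_eq_of_lt (h : Δ x y < Δ y z) : Δ x z = Δ x y := by
  refine le_antisymm ?_ (hΔ.trans _ x y z le_rfl h.le)
  by_contra! h'
  have h1 : min (Δ x z) (Δ y z) ≤ Δ x y :=
    hΔ.trans _ x z y (min_le_left _ _) (by rw [hΔ.comm z y]; exact min_le_right _ _)
  exact (lt_min h' h).not_ge h1

theorem ne_of_firstDifference_eq_coe (h : Δ x y = i) : x ≠ y := fun hxy => by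
  rw [(hΔ.eq_top_iff x y).2 hxy] at h
  exact WithTop.top_ne_coe h

end Tree

open scoped Classical in
/-- The branching levels along `x` in `s` that are at most the level where `x` leaves the subtree
spanned by the list `l`. -/
noncomputable def baseSplits {P Q : Type u} [LinearOrder Q] (Δ : P → P → WithTop Q) (x : P)
    (l : List P) (s : Finset P) : Finset Q :=
  (splits Δ x s).filter fun i => ∃ z ∈ l, (i : WithTop Q) ≤ Δ x z

/-- The natural sum, over the members `x` of the list (read from right to left), of
`ω ^ (θ * b + a)`, where `b` and `a` are the potentials of the branching levels in `s` along `x`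
up to the node at which `x` was attached, and along all of `x`. -/
noncomputable def listPotential {P Q : Type u} [LinearOrder Q] (Δ : P → P → WithTop Q)
    (w : Finset Q → Ordinal.{u}) (θ : Ordinal.{u}) (s : Finset P) : List P → Ordinal.{u}
  | [] => 0
  | x :: l => natAdd (θ * w (baseSplits Δ x l s) + w (splits Δ x s)) (listPotential Δ w θ s l)

section TreePotential

variable {P Q : Type u} [LinearOrder Q] {Δ : P → P → WithTop Q} {K : Set (Finset Q)}
  {w : Finset Q → Ordinal.{u}} {θ : Ordinal.{u}}

theorem baseSplits_subset {x : P} {l : List P} {s : Finset P} :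
    baseSplits Δ x l s ⊆ splits Δ x s := by
  classical
  exact Finset.filter_subset _ _

theorem mem_baseSplits {x : P} {l : List P} {s : Finset P} {i : Q} :
    i ∈ baseSplits Δ x l s ↔ (∃ y ∈ s, Δ x y = i) ∧ ∃ z ∈ l, (i : WithTop Q) ≤ Δ x z := by
  classical
  rw [baseSplits, Finset.mem_filter, mem_splits]

theorem baseSplits_mono {x : P} {l : List P} {s t : Finset P} (h : s ⊆ t) :
    baseSplits Δ x l s ⊆ baseSplits Δ x l t := fun i hi => by
  obtain ⟨⟨y, hy, hxy⟩, hz⟩ := mem_baseSplits.1 hi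
  exact mem_baseSplits.2 ⟨⟨y, h hy, hxy⟩, hz⟩

theorem exponent_le {a b a' b' : Ordinal.{u}} (ha : a ≤ a') (hb : b ≤ b') :
    θ * b + a ≤ θ * b' + a' := by gcongr

theorem exponent_lt {a b b' : Ordinal.{u}} (c : Ordinal.{u}) (ha : a < θ) (hb : b < b') :
    θ * b + a < θ * b' + c :=
  calc θ * b + a < θ * b + θ := (add_lt_add_iff_left _).2 ha
    _ = θ * (b + 1) := (mul_add_one _ _).symm
    _ ≤ θ * b' := by
      gcongr
      exact Order.add_one_le_of_lt hb
    _ ≤ _ := le_self_add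

theorem listPotential_anti (hK : IsHereditary K) (hw : IsPotential K w) {s t : Finset P}
    (ht : t ∈ treeFamily Δ K) (hst : s ⊆ t) (l : List P) (hl : ∀ x ∈ l, x ∈ t) :
    listPotential Δ w θ t l ≤ listPotential Δ w θ s l := by
  induction l with
  | nil => exact le_rfl
  | cons x l ih =>
    have hx : splits Δ x t ∈ K := ht x (hl x (by simp))
    refine natAdd_le_natAdd (exponent_le ?_ ?_) (ih fun z hz => hl z (by simp [hz]))
    · exact hw.le_of_subset hx (splits_mono hst)
    · exact hw.le_of_subset (hK _ hx _ baseSplits_subset) (baseSplits_mono hst)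

/-- Adding a new branch `y` to a set of branches lowers its list potential: the term of the branch
`x` from which `y` branches off drops, and the term of `y` is smaller than the old term of `x`
because `y` is attached above the node at which `x` was attached. -/
theorem listPotential_cons_lt (hΔ : IsFirstDifference Δ) (hK : IsHereditary K)
    (hw : IsPotential K w) (hθ : ∀ v ∈ K, w v < θ) [DecidableEq P] (l : List P) (hl : l ≠ [])
    {s : Finset P} (hs : ∀ x, x ∈ s ↔ x ∈ l) {y : P} (hy : y ∉ s)
    (hys : insert y s ∈ treeFamily Δ K) :
    listPotential Δ w θ (insert y s) (y :: l) < listPotential Δ w θ s l := by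
  classical
  obtain ⟨l₁, x, l₂, rfl, hmax, hlt⟩ := exists_nearest (Δ := Δ) y l hl
  have hxs : x ∈ s := (hs x).2 (by simp)
  obtain ⟨i, hi⟩ : ∃ i : Q, Δ y x = i := by
    cases h : Δ y x with
    | top => exact absurd ((hΔ.eq_top_iff y x).1 h ▸ hxs) hy
    | coe i => exact ⟨i, rfl⟩
  have hxi : Δ x y = i := by rw [hΔ.comm, hi]
  have hyK : splits Δ y (insert y s) ∈ K := hys y (Finset.mem_insert_self _ _)
  have hxK : splits Δ x (insert y s) ∈ K := hys x (Finset.mem_insert_of_mem hxs)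
  -- the level at which `y` leaves `x` is new on `x`, since only two directions leave a node
  have hnew : i ∉ splits Δ x s := fun h => by
    obtain ⟨z, hz, hxz⟩ := mem_splits.1 h
    have h1 := hΔ.binary i x y z hxi hxz
    have h2 := hmax z ((hs z).1 hz)
    rw [hi] at h2
    exact h1.not_ge h2
  have hmem : i ∈ splits Δ x (insert y s) :=
    mem_splits.2 ⟨y, Finset.mem_insert_self _ _, hxi⟩
  have ha : w (splits Δ x (insert y s)) < w (splits Δ x s) :=
    hw _ _ hxK (Finset.ssubset_iff_of_subset (splits_mono (Finset.subset_insert _ _)) |>.2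
      ⟨i, hmem, hnew⟩)
  have hlt' : ∀ z ∈ l₂, Δ x z < i := fun z hz => by
    have h1 := hlt z hz
    rw [hΔ.comm y z, hi] at h1
    have h2 := firstDifference_eq_of_lt hΔ (x := z) (y := y) (z := x) (by rwa [hi])
    rwa [hΔ.comm, h2]
  have hb : w (baseSplits Δ x l₂ (insert y s)) ≤ w (baseSplits Δ x l₂ s) :=
    hw.le_of_subset (hK _ hxK _ baseSplits_subset) (baseSplits_mono (Finset.subset_insert _ _))
  have hby : w (baseSplits Δ y (l₁ ++ x :: l₂) (insert y s)) < w (baseSplits Δ x l₂ s) := by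
    refine hw _ _ (hK _ hyK _ baseSplits_subset) ?_
    refine Finset.ssubset_iff_of_subset (fun j hj => ?_) |>.2 ⟨i, ?_, fun h => ?_⟩
    · obtain ⟨⟨z, hz, hxz⟩, z', hz', hj'⟩ := mem_baseSplits.1 hj
      have hji : (j : WithTop Q) < i := hj'.trans_lt (hlt' z' hz')
      have h1 : Δ z y = Δ z x := firstDifference_eq_of_lt hΔ (by rwa [hxi, hΔ.comm, hxz])
      have h2 : Δ y z = j := by rw [hΔ.comm, h1, hΔ.comm, hxz]
      exact mem_baseSplits.2 ⟨⟨z, Finset.mem_insert_of_mem hz, h2⟩, z, (hs z).1 hz, h2.ge⟩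
    · exact mem_baseSplits.2 ⟨⟨x, Finset.mem_insert_of_mem hxs, hi⟩, x, by simp, hi.ge⟩
    · exact hnew (baseSplits_subset h)
  set ey := θ * w (baseSplits Δ y (l₁ ++ x :: l₂) (insert y s)) +
    w (splits Δ y (insert y s)) with hey
  have hey' : ey < θ * w (baseSplits Δ x l₂ s) + w (splits Δ x s) :=
    exponent_lt _ (hθ _ hyK) hby
  have hex' : θ * w (baseSplits Δ x l₂ (insert y s)) + w (splits Δ x (insert y s)) <
      θ * w (baseSplits Δ x l₂ s) + w (splits Δ x s) :=
    lt_of_lt_of_le ((add_lt_add_iff_left _).2 ha) (exponent_le le_rfl hb)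
  have hsub : ∀ z ∈ l₁ ++ x :: l₂, z ∈ insert y s := fun z hz =>
    Finset.mem_insert_of_mem ((hs z).2 hz)
  change natAdd ey (listPotential Δ w θ (insert y s) (l₁ ++ x :: l₂)) < _
  clear_value ey
  clear hmax hs hl hby hey
  induction l₁ with
  | nil =>
    refine (natAdd_natAdd_lt hex' hey' _).trans_le (natAdd_le_natAdd le_rfl ?_)
    exact listPotential_anti hK hw hys (Finset.subset_insert _ _) _
      fun z hz => hsub z (by simp [hz])
  | cons z l₁ ih =>
    have hz : splits Δ z (insert y s) ∈ K := hys z (hsub z (by simp))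
    rw [List.cons_append, listPotential, natAdd_comm]
    refine (natAdd_strictMono _ (ih fun z hz => hsub z (by simp_all))).trans_le ?_
    refine natAdd_le_natAdd (exponent_le ?_ ?_) le_rfl
    · exact hw.le_of_subset hz (splits_mono (Finset.subset_insert _ _))
    · exact hw.le_of_subset (hK _ hz _ baseSplits_subset)
        (baseSplits_mono (Finset.subset_insert _ _))

/-- A set of branches gets the least list potential over all its enumerations. -/
theorem hasPotential_treeFamily (hΔ : IsFirstDifference Δ) (hK : IsHereditary K)
    {l : Ordinal.{u}} (hl : ExpIndecomposable l) (hω : ω < l) (hp : HasPotential K l) :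
    HasPotential (treeFamily Δ K) l := by
  classical
  obtain ⟨w, hw, hwl⟩ := hp
  set θ := w ∅ + 1 with hθ
  have hθl : θ < l := hl.add_one_lt hwl
  have hKθ : ∀ v ∈ K, w v < θ := fun v hv =>
    Order.lt_add_one_iff.2 (hw.le_of_subset hv (Finset.empty_subset v))
  let M : Ordinal.{u} := ω ^ (θ * w ∅ + w ∅ + 1)
  have hMl : M < l := hl.2 _ hω _ (hl.add_one_lt (hl.add_lt (hl.mul_lt hθl hwl) hwl))
  let Φ : Finset P → Ordinal.{u} := fun s => if s = ∅ then M else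
    sInf {a | ∃ l : List P, (∀ x, x ∈ s ↔ x ∈ l) ∧ a = listPotential Δ w θ s l}
  refine ⟨Φ, isPotential_of_insert (isHereditary_treeFamily hK) fun s y hy hys => ?_, ?_⟩
  · have hins : insert y s ≠ ∅ := Finset.insert_ne_empty _ _
    simp only [Φ, if_neg hins]
    split_ifs with h
    · subst h
      refine lt_of_le_of_lt (csInf_le' ⟨[y], by simp, rfl⟩) ?_
      have hyK := hys y (Finset.mem_insert_self _ _)
      simp only [listPotential, natAdd_zero]
      refine (opow_lt_opow_iff_right one_lt_omega0).2 (Order.lt_add_one_iff.2 (exponent_le ?_ ?_))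
      · exact hw.le_of_subset hyK (Finset.empty_subset _)
      · exact hw.le_of_subset (hK _ hyK _ baseSplits_subset) (Finset.empty_subset _)
    · have hne : {a | ∃ l : List P, (∀ x, x ∈ s ↔ x ∈ l) ∧
          a = listPotential Δ w θ s l}.Nonempty := ⟨_, s.toList, by simp, rfl⟩
      obtain ⟨l', hl', heq⟩ := csInf_mem hne
      rw [heq]
      refine lt_of_le_of_lt (csInf_le' ⟨y :: l', fun x => by simp [hl'], rfl⟩) ?_
      refine listPotential_cons_lt hΔ hK hw hKθ l' ?_ hl' hy hys
      rintro rfl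
      exact h (Finset.eq_empty_of_forall_notMem fun x hx => by simpa using (hl' x).1 hx)
  · simpa [Φ] using hMl

end TreePotential

/-! ### The small rank of a tree family -/

section TreeRank

variable {P Q : Type u} [LinearOrder Q] {Δ : P → P → WithTop Q} {K : Set (Finset Q)}

/-- Along a comb `x` with branching levels `c`, the branching levels of a set of branches `x n` are
among the corresponding `c n`. -/
theorem splits_comb_subset {x : ℕ → P} {c : ℕ → Q} (hΔ : IsFirstDifference Δ)
    (hx : ∀ m n, m < n → Δ (x m) (x n) = c m) {t : Set ℕ} {s : Finset P}
    (hs : ∀ y ∈ s, ∃ n ∈ t, y = x n) {n : ℕ} (hn : n ∈ t) {i : Q} (hi : i ∈ splits Δ (x n) s) :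
    ∃ m ∈ t, i = c m := by
  obtain ⟨y, hy, hxy⟩ := mem_splits.1 hi
  obtain ⟨m, hm, rfl⟩ := hs y hy
  rcases lt_trichotomy n m with h | rfl | h
  · rw [hx _ _ h] at hxy
    exact ⟨n, hn, (WithTop.coe_injective hxy).symm⟩
  · exact absurd rfl (ne_of_firstDifference_eq_coe hΔ hxy)
  · rw [hΔ.comm, hx _ _ h] at hxy
    exact ⟨m, hm, (WithTop.coe_injective hxy).symm⟩

theorem comb_injective {x : ℕ → P} {c : ℕ → Q} (hΔ : IsFirstDifference Δ)
    (hx : ∀ m n, m < n → Δ (x m) (x n) = c m) : Function.Injective x := by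
  intro m n h
  by_contra hne
  rcases lt_or_gt_of_ne hne with h' | h'
  · exact ne_of_firstDifference_eq_coe hΔ (hx _ _ h') h
  · exact ne_of_firstDifference_eq_coe hΔ (hx _ _ h') h.symm

variable [WellFoundedLT Q]

/-- Every infinite set of branches has an infinite subset `A'` and a member `x` such that all
elements of `A'` leave `x` at the same node and stay together beyond it. -/
theorem exists_infinite_subset_firstDifference_eq (hΔ : IsFirstDifference Δ) {A : Set P}
    (hA : A.Infinite) : ∃ x ∈ A, ∃ i : Q, ∃ A' ⊆ A, A'.Infinite ∧ (∀ y ∈ A', Δ x y = i) ∧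
      ∀ y ∈ A', ∀ z ∈ A', (i : WithTop Q) < Δ y z := by
  have hne : {γ | ∃ y ∈ A, ∃ z ∈ A, y ≠ z ∧ γ = Δ y z}.Nonempty := by
    obtain ⟨y, hy, z, hz, hyz⟩ := hA.nontrivial
    exact ⟨_, y, hy, z, hz, hyz, rfl⟩
  obtain ⟨γ, ⟨y, hy, z, hz, hyz, rfl⟩, hmin⟩ := wellFounded_lt.has_min _ hne
  obtain ⟨i, hi⟩ : ∃ i : Q, Δ y z = i := by
    cases h : Δ y z with
    | top => exact absurd ((hΔ.eq_top_iff y z).1 h) hyz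
    | coe i => exact ⟨i, rfl⟩
  have hle : ∀ a ∈ A, (i : WithTop Q) ≤ Δ y a := fun a ha => by
    rcases eq_or_ne y a with rfl | hne
    · rw [(hΔ.eq_top_iff y y).2 rfl]
      exact le_top
    · rw [← hi]
      exact not_lt.1 (hmin _ ⟨y, hy, a, ha, hne, rfl⟩)
  have hcover : A ⊆ {a ∈ A | Δ y a = i} ∪ {a ∈ A | (i : WithTop Q) < Δ y a} := fun a ha =>
    (hle a ha).eq_or_lt.imp (fun h => ⟨ha, h.symm⟩) fun h => ⟨ha, h⟩
  rcases Set.infinite_union.1 (hA.mono hcover) with h | h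
  · exact ⟨y, hy, i, _, Set.sep_subset _ _, h, fun a ha => ha.2,
      fun a ha b hb => hΔ.binary i y a b ha.2 hb.2⟩
  · refine ⟨z, hz, i, _, Set.sep_subset _ _, h, fun a ha => ?_, fun a ha b hb => ?_⟩
    · have h1 : Δ z y = i := by rw [hΔ.comm, hi]
      rw [firstDifference_eq_of_lt hΔ (by rw [h1]; exact ha.2), h1]
    · refine lt_of_lt_of_le (lt_min ha.2 hb.2) (hΔ.trans _ a y b ?_ (min_le_right _ _))
      rw [hΔ.comm]
      exact min_le_left _ _

/-- Every infinite set of branches contains a comb. -/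
theorem exists_comb (hΔ : IsFirstDifference Δ) {A : Set P} (hA : A.Infinite) :
    ∃ x : ℕ → P, ∃ c : ℕ → Q, StrictMono c ∧ (∀ n, x n ∈ A) ∧
      ∀ m n, m < n → Δ (x m) (x n) = c m := by
  choose x hx i A' hsub hinf heq hlt using
    fun B : {B : Set P // B.Infinite} => exists_infinite_subset_firstDifference_eq hΔ B.2
  let S : ℕ → {B : Set P // B.Infinite} := fun n => Nat.rec ⟨A, hA⟩ (fun _ B => ⟨A' B, hinf B⟩) n
  have hS : ∀ n, (S (n + 1)).1 = A' (S n) := fun n => rfl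
  have hanti : Antitone fun n => (S n).1 := antitone_nat_of_succ_le fun n => hsub (S n)
  have hmem : ∀ m n, m ≤ n → x (S n) ∈ (S m).1 := fun m n h => hanti h (hx (S n))
  have hΔx : ∀ m n, m < n → Δ (x (S m)) (x (S n)) = i (S m) := fun m n h =>
    heq _ _ (hmem (m + 1) n h)
  refine ⟨fun n => x (S n), fun n => i (S n), strictMono_nat_of_lt_succ fun n => ?_,
    fun n => hmem 0 n n.zero_le, hΔx⟩
  have := hlt (S n) _ (hmem (n + 1) (n + 1) le_rfl) _ (hmem (n + 1) (n + 2) (Nat.le_succ _))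
  rw [hΔx (n + 1) (n + 2) (Nat.lt_succ_self _)] at this
  exact WithTop.coe_lt_coe.1 this

/-- An infinite subset of a well-order contains a strictly increasing sequence. -/
theorem exists_strictMono_seq {D : Set Q} (hD : D.Infinite) :
    ∃ c : ℕ → Q, StrictMono c ∧ ∀ n, c n ∈ D := by
  let f := hD.natEmbedding
  obtain ⟨g, hg | hg⟩ := exists_increasing_or_nonincreasing_subseq (· < ·) fun n => (f n : Q)
  · exact ⟨fun n => f (g n), fun m n h => hg m n h, fun n => (f (g n)).2⟩
  · exfalso
    have hlt : ∀ n, (f (g (n + 1)) : Q) < f (g n) := fun n => by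
      refine lt_of_le_of_ne (not_lt.1 (hg n (n + 1) n.lt_succ_self)) fun h => ?_
      have := g.injective (f.injective (Subtype.ext h))
      omega
    exact (RelEmbedding.natGT (r := (· < ·)) (fun n => (f (g n) : Q)) hlt).not_wellFounded
      wellFounded_lt

variable [PartialOrder P]

/-- Every infinite set of branches contains a comb, and sets of levels of the comb in `K` give
sets of branches in `treeFamily Δ K`. -/
theorem srk_le_srk_treeFamily (htotQ : ∀ A : Set Q, IsCh A) (hΔ : IsFirstDifference Δ)
    (hP : ∃ C : Set P, C.Infinite ∧ IsCh C) (hK : IsHereditary K) (hc : IsCompactFamily K)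
    (h0 : ∅ ∈ K) (hcT : IsCompactFamily (treeFamily Δ K)) : srk K ≤ srk (treeFamily Δ K) := by
  classical
  refine le_srk hP fun C hC _ => ?_
  obtain ⟨x, c, hmono, hxC, hx⟩ := exists_comb hΔ hC
  have hT := isHereditary_treeFamily (Δ := Δ) hK
  refine (srk_le (Set.infinite_range_of_injective hmono.injective) (htotQ _)).trans ?_
  rw [le_rk_iff (hT.restrict C) (hcT.restrict hT C) ⟨by simp [treeFamily], by simp⟩]
  have h1 := (le_rk_iff (hK.restrict (Set.range c)) (hc.restrict hK _) ⟨h0, by simp⟩).1 le_rfl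
  have hf : ∀ n, Function.extend c x (fun _ => x 0) (c n) = x n :=
    fun n => hmono.injective.extend_apply x _ n
  have := h1.image (f := Function.extend c x fun _ => x 0) (A := Set.range c)
    (G := restrict (treeFamily Δ K) C) ?_ (fun s hs => hs.2) ?_
  · simpa using this
  · rintro _ ⟨m, rfl⟩ _ ⟨n, rfl⟩ h
    rw [hf, hf] at h
    rw [comb_injective hΔ hx h]
  · intro s hs
    have hmem : ∀ y ∈ s.image (Function.extend c x fun _ => x 0),
        ∃ n ∈ {n | c n ∈ s}, y = x n := by
      intro y hy
      obtain ⟨j, hj, rfl⟩ := Finset.mem_image.1 hy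
      obtain ⟨n, rfl⟩ := hs.2 hj
      exact ⟨n, hj, hf n⟩
    refine ⟨fun y hy => ?_, fun y hy => ?_⟩
    · obtain ⟨n, hn, rfl⟩ := hmem y hy
      refine hK _ hs.1 _ fun i hi => ?_
      obtain ⟨m, hm, rfl⟩ := splits_comb_subset hΔ hx hmem hn hi
      exact hm
    · obtain ⟨n, -, rfl⟩ := hmem y hy
      exact hxC n

/-- For the upper bound, take a comb over a set `D` of levels where the small rank of `K` is
attained. A set of branches of the comb that survives `1 + α` derivatives has its levels in the
`α`-th derivative of `K`, and `1 + α = α` for infinite `α`. -/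
theorem srk_treeFamily (htotQ : ∀ A : Set Q, IsCh A) (htot : ∀ A : Set P, IsCh A)
    [Infinite P] [Infinite Q] (hΔ : IsFirstDifference Δ)
    (hK : IsHereditary K) (hc : IsCompactFamily K)
    (h0 : ∅ ∈ K) (hcT : IsCompactFamily (treeFamily Δ K)) (hω : ω ≤ srk K) :
    srk (treeFamily Δ K) = srk K := by
  classical
  refine le_antisymm ?_
    (srk_le_srk_treeFamily htotQ hΔ (exists_infinite_ch htot) hK hc h0 hcT)
  obtain ⟨D, hD, -, hsrk⟩ := exists_srk_eq_rk (exists_infinite_ch htotQ) K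
  obtain ⟨c, hmono, hcD⟩ := exists_strictMono_seq hD
  obtain ⟨x, hx⟩ := hΔ.comb c hmono
  have hinj := comb_injective hΔ hx
  have hT := isHereditary_treeFamily (Δ := Δ) hK
  refine (srk_le (Set.infinite_range_of_injective hinj) (htot _)).trans ?_
  have key : ∀ α : Ordinal.{u}, ∀ t : Finset ℕ,
      HasRk (restrict (treeFamily Δ K) (Set.range x)) (1 + α) (t.image x) →
      HasRk (restrict K D) α (t.image c) := by
    intro α
    induction α using WellFoundedLT.induction with
    | ind α ih =>
      intro t h
      rw [hasRk_iff] at h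
      rw [hasRk_iff]
      refine ⟨⟨?_, ?_⟩, fun β hβ => ?_⟩
      · -- a branch of the comb beyond `t` sees exactly the levels `c n`, `n ∈ t`
        obtain ⟨y, hy, hyt⟩ := (h.2 0 (zero_lt_one.trans_le le_self_add)).exists_notMem_finset
          ((Finset.range (t.sup id + 1)).image x)
        obtain ⟨hyT, hyr⟩ := hasRk_zero.1 hy
        obtain ⟨n, rfl⟩ := hyr (Finset.mem_insert_self _ _)
        have hn : ∀ m ∈ t, m < n := fun m hm => by
          by_contra! hle
          refine hyt (Finset.mem_image_of_mem x (Finset.mem_range.2 ?_))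
          exact Nat.lt_succ_of_le (hle.trans (Finset.le_sup (f := id) hm))
        refine hK _ (hyT _ (Finset.mem_insert_self _ _)) _ fun i hi => ?_
        obtain ⟨m, hm, rfl⟩ := Finset.mem_image.1 hi
        refine mem_splits.2 ⟨x m, ?_, ?_⟩
        · exact Finset.mem_insert_of_mem (Finset.mem_image_of_mem x hm)
        · rw [hΔ.comm, hx _ _ (hn m hm)]
      · intro i hi
        obtain ⟨m, -, rfl⟩ := Finset.mem_image.1 (Finset.mem_coe.1 hi)
        exact hcD m
      · have h1 := h.2 (1 + β) ((add_lt_add_iff_left _).2 hβ)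
        have h2 := h1.preimage (f := x) fun y hy => (HasRk.mem hy).2 (by simp)
        refine (h2.image hmono.injective.injOn).mono ?_
        rintro _ ⟨n, hn, rfl⟩
        change HasRk _ _ _ at hn
        have := ih β hβ (insert n t) (by rw [Finset.image_insert]; convert hn)
        rw [Finset.image_insert] at this
        change HasRk _ _ _
        convert this
  by_contra! hlt
  have h1 := (le_rk_iff (hT.restrict (Set.range x)) (hcT.restrict hT _)
    ⟨by simp [treeFamily], by simp⟩).1 (Order.add_one_le_of_lt hlt)
  rw [← one_add_of_omega0_le (hω.trans le_self_add)] at h1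
  have h2 := key _ ∅ (by simpa using h1)
  have h3 := (le_rk_iff (hK.restrict D) (hc.restrict hK D) ⟨h0, by simp⟩).2 (by simpa using h2)
  rw [← hsrk] at h3
  exact (lt_add_one _).not_ge h3

end TreeRank

/-! ### Unions of sequences in tree families -/

section Sequences

variable {P Q : Type u} [LinearOrder Q] {Δ : P → P → WithTop Q}

/-- A tree of nodes contains, through each of its nodes, a branch `p` that leaves the tree only at
a level where no other node of the tree extends it. -/
theorem exists_maximal_branch (hΔ : IsFirstDifference Δ) {T : P → WithTop Q → Prop}
    (hT : ∀ x y γ, T x γ → γ ≤ Δ x y → T y γ) {x : P} {γ : WithTop Q} (hx : T x γ) :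
    ∃ p, γ ≤ Δ x p ∧ ∀ y η, T y η → Δ y p < η → ∃ η', Δ y p < η' ∧ T p η' := by
  let r : {a : P × WithTop Q // T a.1 a.2} → {a : P × WithTop Q // T a.1 a.2} → Prop :=
    fun a b => min a.1.2 b.1.2 ≤ Δ a.1.1 b.1.1
  have hsymm : ∀ a b, r a b → r b a := fun a b h => by
    change min b.1.2 a.1.2 ≤ Δ b.1.1 a.1.1
    rw [min_comm, hΔ.comm]
    exact h
  have hrefl : ∀ a, r a a := fun a => by
    change _ ≤ Δ a.1.1 a.1.1
    rw [(hΔ.eq_top_iff _ _).2 rfl]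
    exact le_top
  obtain ⟨M, hM, hxM⟩ := (IsChain.singleton (r := r) (a := ⟨(x, γ), hx⟩)).exists_maxChain
  have hMr : ∀ a ∈ M, ∀ b ∈ M, r a b := fun a ha b hb => by
    rcases eq_or_ne a b with rfl | h
    · exact hrefl a
    · exact (hM.1 ha hb h).elim id (hsymm b a)
  obtain ⟨p, hp⟩ := hΔ.complete (Subtype.val '' M) (by
    rintro _ ⟨a, ha, rfl⟩ _ ⟨b, hb, rfl⟩
    exact hMr a ha b hb)
  have hp' : ∀ a ∈ M, a.1.2 ≤ Δ a.1.1 p := fun a ha => hp _ ⟨a, ha, rfl⟩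
  refine ⟨p, hp' _ (hxM rfl), fun y η hy hlt => ?_⟩
  by_contra! hcon
  have hins : IsChain r (insert ⟨(y, η), hy⟩ M) := by
    refine hM.1.insert fun b hb _ => Or.inl ?_
    have hb' : b.1.2 ≤ Δ y p := by
      by_contra! h
      exact hcon _ h (hT _ _ _ b.2 (hp' b hb))
    refine (min_le_right _ _).trans (hΔ.trans _ y p b.1.1 hb' ?_)
    rw [hΔ.comm]
    exact hp' b hb
  have heq := hM.2 hins (Set.subset_insert _ _)
  exact (hp' ⟨(y, η), hy⟩ (heq ▸ Set.mem_insert _ _)).not_gt hlt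

/-- The node below level `γ` of `x` belongs to the limit, along a free ultrafilter, of the trees
spanned by the sets `s n`. -/
def LimitNode (Δ : P → P → WithTop Q) (s : ℕ → Finset P) (x : P) (γ : WithTop Q) : Prop :=
  ∀ᶠ m in (Filter.hyperfilter ℕ : Filter ℕ), ∃ y ∈ s m, γ ≤ Δ x y

variable {s : ℕ → Finset P} {K : Set (Finset Q)}

theorem LimitNode.anti {x : P} {γ η : WithTop Q} (h : LimitNode Δ s x γ) (hη : η ≤ γ) :
    LimitNode Δ s x η :=
  h.mono fun _ ⟨y, hy, hxy⟩ => ⟨y, hy, hη.trans hxy⟩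

theorem LimitNode.congr (hΔ : IsFirstDifference Δ) {x y : P} {γ : WithTop Q}
    (h : LimitNode Δ s x γ) (hγ : γ ≤ Δ x y) : LimitNode Δ s y γ :=
  h.mono fun _ ⟨z, hz, hxz⟩ => ⟨z, hz, hΔ.trans _ y x z (by rwa [hΔ.comm]) hxz⟩

/-- A finite set of branches that are separated from each other within the limit tree is copied
with the same first differences into some `s m`. -/
theorem mem_treeFamily_of_separated (hΔ : IsFirstDifference Δ) (hK : IsHereditary K)
    (h0 : ∅ ∈ K) (hs : ∀ n, s n ∈ treeFamily Δ K) {W : Finset P}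
    (hW : ∀ p ∈ W, ∀ q ∈ W, p ≠ q → ∃ η, Δ p q < η ∧ LimitNode Δ s p η) :
    W ∈ treeFamily Δ K := by
  classical
  have hev : ∀ᶠ m in (Filter.hyperfilter ℕ : Filter ℕ), ∀ p ∈ W, ∀ q ∈ W, p ≠ q →
      ∃ y ∈ s m, Δ p q < Δ p y := by
    rw [Filter.eventually_all_finset]
    intro p hp
    rw [Filter.eventually_all_finset]
    intro q hq
    rcases eq_or_ne p q with rfl | hpq
    · exact Filter.Eventually.of_forall fun _ h => absurd rfl h
    · obtain ⟨η, hη, hT⟩ := hW p hp q hq hpq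
      exact hT.mono fun m ⟨y, hy, hpy⟩ _ => ⟨y, hy, hη.trans_le hpy⟩
  obtain ⟨m, hm⟩ := hev.exists
  rcases (s m).eq_empty_or_nonempty with hem | hne
  · intro p hp
    convert h0
    refine Finset.eq_empty_of_forall_notMem fun i hi => ?_
    obtain ⟨q, hq, hpq⟩ := mem_splits.1 hi
    obtain ⟨y, hy, -⟩ := hm p hp q hq (ne_of_firstDifference_eq_coe hΔ hpq)
    simp [hem] at hy
  · choose y hy hmax using fun p => (s m).exists_max_image (Δ p) hne
    have hlt : ∀ p ∈ W, ∀ q ∈ W, p ≠ q → Δ p q < Δ p (y p) := fun p hp q hq hpq => by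
      obtain ⟨z, hz, hpz⟩ := hm p hp q hq hpq
      exact hpz.trans_le (hmax p z hz)
    intro p hp
    refine hK _ (hs m (y p) (hy p)) _ fun i hi => ?_
    obtain ⟨q, hq, hpq⟩ := mem_splits.1 hi
    have hne := ne_of_firstDifference_eq_coe hΔ hpq
    refine mem_splits.2 ⟨y q, hy q, ?_⟩
    have h1 : Δ p (y q) = Δ p q :=
      firstDifference_eq_of_lt hΔ (by rw [hΔ.comm p q]; exact hlt q hq p hp hne.symm)
    have h2 : Δ (y q) (y p) = Δ (y q) p :=
      firstDifference_eq_of_lt hΔ (by rw [hΔ.comm, h1]; exact hlt p hp q hq hne)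
    rw [hΔ.comm, h2, hΔ.comm, h1, hpq]

/-- The limit tree of a sequence in `treeFamily Δ K` is covered by finitely many branches. -/
theorem exists_finset_cover_limitNode (hΔ : IsFirstDifference Δ) (hK : IsHereditary K)
    (h0 : ∅ ∈ K) {Φ : Finset P → Ordinal.{u}} (hΦ : IsPotential (treeFamily Δ K) Φ)
    (hs : ∀ n, s n ∈ treeFamily Δ K) :
    ∃ W : Finset P, ∀ x γ, LimitNode Δ s x γ → ∃ p ∈ W, γ ≤ Δ x p := by
  classical
  let S : Set (Finset P) := {W |
    (∀ p ∈ W, ∀ y η, LimitNode Δ s y η → Δ y p < η → ∃ η', Δ y p < η' ∧ LimitNode Δ s p η') ∧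
    ∀ p ∈ W, ∀ q ∈ W, p ≠ q → ∃ η, Δ p q < η ∧ LimitNode Δ s p η}
  -- a separated set of maximal branches of least potential cannot be enlarged
  obtain ⟨W, hW, hmin⟩ := (InvImage.wf Φ wellFounded_lt).has_min S ⟨∅, by simp, by simp⟩
  refine ⟨W, fun x γ hx => ?_⟩
  by_contra! hcon
  obtain ⟨p, hp, hpmax⟩ := exists_maximal_branch hΔ
    (T := LimitNode Δ s) (fun x y γ h h' => h.congr hΔ h') hx
  have hpT : LimitNode Δ s p γ := hx.congr hΔ hp
  have hpq : ∀ q ∈ W, Δ p q < γ := fun q hq => by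
    have h1 : Δ q p = Δ q x :=
      firstDifference_eq_of_lt hΔ (by rw [hΔ.comm]; exact (hcon q hq).trans_le hp)
    rw [hΔ.comm, h1, hΔ.comm]
    exact hcon q hq
  have hpW : p ∉ W := fun h => (hcon p h).not_ge hp
  have hins : insert p W ∈ S := by
    refine ⟨fun q hq => ?_, fun q hq q' hq' hne => ?_⟩
    · rcases Finset.mem_insert.1 hq with rfl | hq
      · exact hpmax
      · exact hW.1 q hq
    · rcases Finset.mem_insert.1 hq with rfl | hqW <;>
        rcases Finset.mem_insert.1 hq' with rfl | hqW'
      · exact absurd rfl hne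
      · exact ⟨γ, hpq q' hqW', hpT⟩
      · have h1 := hpq q hqW
        obtain ⟨η, hη, hT⟩ := hW.1 q hqW _ γ hpT h1
        exact ⟨η, by rwa [hΔ.comm], hT⟩
      · exact hW.2 q hqW q' hqW' hne
  exact hmin _ hins (hΦ _ _ (mem_treeFamily_of_separated hΔ hK h0 hs hins.2)
    (Finset.ssubset_insert hpW))

/-- Along a subsequence, the trees spanned by two different members of a sequence meet only inside
the limit tree. -/
theorem exists_subseq_limitNode [WellFoundedLT Q] (hΔ : IsFirstDifference Δ) (s : ℕ → Finset P) :
    ∃ φ : ℕ → ℕ, StrictMono φ ∧ ∀ m n, m ≠ n → ∀ x ∈ s (φ m), ∀ y ∈ s (φ n),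
      LimitNode Δ s x (Δ x y) := by
  have hx : ∀ x, ∀ᶠ m in (Filter.hyperfilter ℕ : Filter ℕ), ∀ y ∈ s m,
      LimitNode Δ s x (Δ x y) := by
    intro x
    by_cases htop : LimitNode Δ s x ⊤
    · exact Filter.Eventually.of_forall fun m y _ => htop.anti le_top
    · obtain ⟨γ, hγ, hmin⟩ := wellFounded_lt.has_min {γ | ¬ LimitNode Δ s x γ} ⟨⊤, htop⟩
      refine (Ultrafilter.eventually_not.2 hγ).mono fun m hm y hy => ?_
      by_contra hn
      exact hm ⟨y, hy, not_lt.1 (hmin _ hn)⟩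
  obtain ⟨φ, -, hφ⟩ := exists_seq_of_forall_finset_exists (fun _ : ℕ => True)
    (fun n m => n < m ∧ ∀ x ∈ s n, ∀ y ∈ s m, LimitNode Δ s x (Δ x y)) (fun S _ => by
      have h1 : ∀ᶠ m in (Filter.hyperfilter ℕ : Filter ℕ), ∀ n ∈ S,
          n < m ∧ ∀ x ∈ s n, ∀ y ∈ s m, LimitNode Δ s x (Δ x y) := by
        rw [Filter.eventually_all_finset]
        intro n _
        refine Filter.Eventually.and ?_ ?_
        · refine (Filter.eventually_gt_atTop n).filter_mono ?_
          rw [← Nat.cofinite_eq_atTop]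
          exact Filter.hyperfilter_le_cofinite
        · rw [Filter.eventually_all_finset]
          exact fun x _ => hx x
      obtain ⟨m, hm⟩ := h1.exists
      exact ⟨m, trivial, hm⟩)
  refine ⟨φ, fun m n h => (hφ m n h).1, fun m n hmn x hx y hy => ?_⟩
  rcases lt_or_gt_of_ne hmn with h | h
  · exact (hφ m n h).2 x hx y hy
  · have h1 := (hφ n m h).2 y hy x hx
    rw [hΔ.comm]
    exact h1.congr hΔ le_rfl

/-- The levels at which a branch `p` leaves the members of `s ∈ treeFamily Δ K` are the branching
levels along the member of `s` nearest to `p`, and one more level. -/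
theorem exists_cover_firstDifference (htotQ : ∀ A : Set Q, IsCh A)
    (hΔ : IsFirstDifference Δ) (h0 : ∅ ∈ K) (p : P) {t : Finset P} (ht : t ∈ treeFamily Δ K) :
    ∃ u ∈ K, ∃ e ∈ cube Q 1, ∀ y ∈ t, ∀ i : Q, Δ p y = i → i ∈ u ∨ i ∈ e := by
  rcases t.eq_empty_or_nonempty with rfl | hne
  · exact ⟨∅, h0, ∅, empty_mem_cube 1, by simp⟩
  · obtain ⟨z, hz, hmax⟩ := t.exists_max_image (Δ p) hne
    have hlt : ∀ y ∈ t, ∀ i : Q, Δ p y = i → Δ p y < Δ p z → i ∈ splits Δ z t :=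
      fun y hy i hi h => by
        have h1 : Δ y z = Δ y p := firstDifference_eq_of_lt hΔ (by rwa [hΔ.comm])
        exact mem_splits.2 ⟨y, hy, by rw [hΔ.comm, h1, hΔ.comm, hi]⟩
    cases h : Δ p z with
    | top =>
      refine ⟨splits Δ z t, ht z hz, ∅, empty_mem_cube 1, fun y hy i hi => Or.inl ?_⟩
      exact hlt y hy i hi (by rw [h, hi]; exact WithTop.coe_lt_top i)
    | coe j =>
      refine ⟨splits Δ z t, ht z hz, {j}, ⟨htotQ _, by simp⟩, fun y hy i hi => ?_⟩
      rcases (hmax y hy).lt_or_eq with h' | h'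
      · exact Or.inl (hlt y hy i hi h')
      · rw [hi, h] at h'
        exact Or.inr (by simpa using WithTop.coe_injective h')

end Sequences

/-- `ManyUnions K H L`: every sequence in `K` has a subsequence such that the unions over the
members of `H` are covered by members of `L`. -/
def ManyUnions {Q : Type u} (K : Set (Finset Q)) (H : Set (Finset ℕ)) (L : Set (Finset Q)) :
    Prop :=
  ∀ u : ℕ → Finset Q, (∀ n, u n ∈ K) → ∃ φ : ℕ → ℕ, StrictMono φ ∧
    ∀ X ∈ H, ∃ v ∈ L, ∀ n ∈ X, u (φ n) ⊆ v

section ManyUnions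

variable {P Q : Type u} {K L : Set (Finset Q)} {H : Set (Finset ℕ)}

theorem IsSpreading.image_mem (hH : IsSpreading H) {ψ : ℕ → ℕ} (hψ : StrictMono ψ)
    {X : Finset ℕ} (hX : X ∈ H) : X.image ψ ∈ H := by
  have h1 : Finset.univ.image (X.orderEmbOfFin rfl) = X := by
    rw [← Finset.coe_inj]
    simp
  have h2 := hH X.card (X.orderEmbOfFin rfl) (ψ ∘ X.orderEmbOfFin rfl)
    (X.orderEmbOfFin rfl).strictMono (hψ.comp (X.orderEmbOfFin rfl).strictMono)
    (fun i => hψ.le_apply) (by rwa [h1])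
  rw [← Finset.image_image, h1] at h2
  exact h2

/-- Finitely many sequences can be thinned out simultaneously, since `H` is spreading. -/
theorem ManyUnions.exists_common_subseq (h : ManyUnions K H L) (hH : IsSpreading H)
    (u : P → ℕ → Finset Q) (hu : ∀ p n, u p n ∈ K) (W : Finset P) :
    ∃ φ : ℕ → ℕ, StrictMono φ ∧ ∀ p ∈ W, ∀ X ∈ H, ∃ v ∈ L, ∀ n ∈ X, u p (φ n) ⊆ v := by
  classical
  induction W using Finset.induction_on with
  | empty => exact ⟨id, strictMono_id, by simp⟩
  | insert p W _ ih =>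
    obtain ⟨φ, hφ, hW⟩ := ih
    obtain ⟨ψ, hψ, hp⟩ := h (fun n => u p (φ n)) fun n => hu p _
    refine ⟨φ ∘ ψ, hφ.comp hψ, fun q hq X hX => ?_⟩
    rcases Finset.mem_insert.1 hq with rfl | hq
    · exact hp X hX
    · obtain ⟨v, hv, hsub⟩ := hW q hq _ (hH.image_mem hψ hX)
      exact ⟨v, hv, fun n hn => hsub _ (Finset.mem_image_of_mem ψ hn)⟩

theorem mem_chainSup_of_forall [PartialOrder Q] (htotQ : ∀ A : Set Q, IsCh A)
    (hK : IsHereditary K) (hL : IsHereditary L) {a b c : Finset Q} (ha : a ∈ K) (hb : b ∈ L)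
    (h : ∀ i ∈ c, i ∈ a ∨ i ∈ b) : c ∈ chainSup K L := by
  classical
  refine isHereditary_chainSup hK hL _ (mem_chainSup.2 ⟨htotQ _, a, ha, b, hb, rfl⟩) c
    fun i hi => ?_
  simpa using h i hi

/-- Sequences in `treeFamily Δ K` can be multiplied by `H` if sequences in `K` and sequences of
points can. Up to a subsequence the trees spanned by the members of the sequence meet only along
finitely many branches `p`. So a branch `x` of one of them sees the others only at levels where
they leave one fixed `p`, and these come from the branching levels along the members nearest to
`p`. -/
theorem exists_subseq_mem_treeFamily [LinearOrder Q] [WellFoundedLT Q]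
    {Δ : P → P → WithTop Q} (htotQ : ∀ A : Set Q, IsCh A) (hΔ : IsFirstDifference Δ)
    {L' : Set (Finset Q)} (hK : IsHereditary K) (hL : IsHereditary L) (hL' : IsHereditary L')
    (h0 : ∅ ∈ K) (h0L : ∅ ∈ L) (h0L' : ∅ ∈ L')
    {Φ : Finset P → Ordinal.{u}} (hΦ : IsPotential (treeFamily Δ K) Φ)
    (hH : IsSpreading H) (hKL : ManyUnions K H L) (hL1 : ManyUnions (cube Q 1) H L')
    (s : ℕ → Finset P) (hs : ∀ n, s n ∈ treeFamily Δ K) :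
    ∃ φ : ℕ → ℕ, StrictMono φ ∧ ∀ X ∈ H, ∀ S : Finset P, (∀ y ∈ S, ∃ n ∈ X, y ∈ s (φ n)) →
      S ∈ treeFamily Δ (chainSup (chainSup K (cube Q 1)) (chainSup L L')) := by
  classical
  obtain ⟨W, hW⟩ := exists_finset_cover_limitNode hΔ hK h0 hΦ hs
  obtain ⟨φ₁, hφ₁, hlim⟩ := exists_subseq_limitNode hΔ s
  choose u hu e he hue using fun (p : P) (n : ℕ) =>
    exists_cover_firstDifference htotQ hΔ h0 p (hs (φ₁ n))
  obtain ⟨φ₂, hφ₂, hu₂⟩ := hKL.exists_common_subseq hH u hu W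
  obtain ⟨φ₃, hφ₃, he₃⟩ := hL1.exists_common_subseq hH (fun p n => e p (φ₂ n))
    (fun p n => he p _) W
  refine ⟨fun n => φ₁ (φ₂ (φ₃ n)), hφ₁.comp (hφ₂.comp hφ₃), fun X hX S hS x hx => ?_⟩
  obtain ⟨n, hn, hxn⟩ := hS x hx
  have hK1 : IsHereditary (chainSup K (cube Q 1)) := isHereditary_chainSup hK (cube_hereditary 1)
  have hLL : IsHereditary (chainSup L L') := isHereditary_chainSup hL hL'
  have hcov : ∀ i ∈ splits Δ x S, i ∈ splits Δ x (s (φ₁ (φ₂ (φ₃ n)))) ∨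
      ∃ m ∈ X, ∃ y ∈ s (φ₁ (φ₂ (φ₃ m))), Δ x y = i ∧ ∃ p ∈ W, (i : WithTop Q) ≤ Δ x p := by
    intro i hi
    obtain ⟨y, hy, hxy⟩ := mem_splits.1 hi
    obtain ⟨m, hm, hym⟩ := hS y hy
    rcases eq_or_ne n m with rfl | hnm
    · exact Or.inl (mem_splits.2 ⟨y, hym, hxy⟩)
    · refine Or.inr ⟨m, hm, y, hym, hxy, ?_⟩
      have := hlim (φ₂ (φ₃ n)) (φ₂ (φ₃ m)) (fun h => hnm ((hφ₂.comp hφ₃).injective h))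
        x hxn y hym
      rw [hxy] at this
      exact hW x _ this
  rcases W.eq_empty_or_nonempty with rfl | hne
  · refine mem_chainSup_of_forall htotQ hK1 hLL
      (mem_chainSup_of_forall htotQ hK (cube_hereditary 1) (hs _ x hxn) (empty_mem_cube 1)
        fun i hi => Or.inl hi)
      (mem_chainSup_of_forall htotQ hL hL' h0L h0L' (c := ∅) (by simp)) fun i hi => Or.inl ?_
    refine (hcov i hi).resolve_right ?_
    simp
  · -- the covering branch that follows `x` longest
    obtain ⟨p, hp, hmax⟩ := W.exists_max_image (Δ x) hne
    obtain ⟨v, hv, hvX⟩ := hu₂ p hp _ (hH.image_mem hφ₃ hX)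
    obtain ⟨v', hv', hvX'⟩ := he₃ p hp X hX
    obtain ⟨d, hd, hdx⟩ : ∃ d ∈ cube Q 1, ∀ i : Q, Δ x p = i → i ∈ d := by
      cases h : Δ x p with
      | top => exact ⟨∅, empty_mem_cube 1, fun i hi => absurd hi WithTop.top_ne_coe⟩
      | coe j => exact ⟨{j}, ⟨htotQ _, by simp⟩, fun i hi => by
          simpa using (WithTop.coe_injective hi).symm⟩
    refine mem_chainSup_of_forall htotQ hK1 hLL
      (mem_chainSup_of_forall htotQ hK (cube_hereditary 1) (hs _ x hxn) hd
        (c := splits Δ x (s (φ₁ (φ₂ (φ₃ n)))) ∪ d) fun i hi => by simpa using hi)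
      (mem_chainSup_of_forall htotQ hL hL' hv hv' (c := v ∪ v') fun i hi => by simpa using hi)
      fun i hi => ?_
    rw [Finset.mem_union, Finset.mem_union]
    rcases hcov i hi with h | ⟨m, hm, y, hy, hxy, q, hq, hxq⟩
    · exact Or.inl (Or.inl h)
    · rcases (hxq.trans (hmax q hq)).eq_or_lt with h | h
      · exact Or.inl (Or.inr (hdx i h.symm))
      · have h1 : Δ y p = Δ y x := firstDifference_eq_of_lt hΔ (by rwa [hΔ.comm, hxy])
        have h2 : Δ p y = i := by rw [hΔ.comm, h1, hΔ.comm, hxy]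
        refine Or.inr ((hue p (φ₂ (φ₃ m)) y hy i h2).imp (fun h => ?_) fun h => ?_)
        · exact hvX _ (Finset.mem_image_of_mem φ₃ hm) h
        · exact hvX' m hm h

end ManyUnions

/-! ### First differences in `2 ^ Q` -/

section FirstDifference

variable {P Q : Type u} [LinearOrder Q] [WellFoundedLT Q] (e : P ≃ (Q → Bool))

open scoped Classical in
/-- The first difference of two points of `2 ^ Q`, with value `⊤` if they are equal. -/
noncomputable def firstDifference (x y : P) : WithTop Q :=
  if h : ∃ i, e x i ≠ e y i then
    ((WellFounded.min wellFounded_lt {i | e x i ≠ e y i} h : Q) : WithTop Q)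
  else ⊤

variable {e}

theorem le_firstDifference_iff {γ : WithTop Q} {x y : P} :
    γ ≤ firstDifference e x y ↔ ∀ i : Q, (i : WithTop Q) < γ → e x i = e y i := by
  rw [firstDifference]
  split_ifs with h
  · constructor
    · intro hγ i hi
      by_contra hne
      exact WellFounded.not_lt_min wellFounded_lt (s := {i | e x i ≠ e y i}) hne
        (WithTop.coe_lt_coe.1 (hi.trans_le hγ))
    · intro hγ
      by_contra! hlt
      exact WellFounded.min_mem wellFounded_lt {i | e x i ≠ e y i} h (hγ _ hlt)
  · push Not at h
    exact ⟨fun _ i _ => h i, fun _ => le_top⟩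

theorem firstDifference_eq_coe_iff {i : Q} {x y : P} :
    firstDifference e x y = i ↔ e x i ≠ e y i ∧ ∀ j < i, e x j = e y j := by
  constructor
  · intro h
    refine ⟨fun heq => ?_, fun j hj =>
      le_firstDifference_iff.1 h.ge j (WithTop.coe_lt_coe.2 hj)⟩
    rw [firstDifference] at h
    split_ifs at h with h'
    swap
    · exact WithTop.top_ne_coe h
    have := WellFounded.min_mem wellFounded_lt {i | e x i ≠ e y i} h'
    rw [WithTop.coe_injective h] at this
    exact this heq
  · rintro ⟨h1, h2⟩
    refine le_antisymm ?_ (le_firstDifference_iff.2 fun j hj => h2 j (WithTop.coe_lt_coe.1 hj))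
    by_contra! hlt
    exact h1 (le_firstDifference_iff.1 le_rfl i hlt)

theorem isFirstDifference_firstDifference : IsFirstDifference (firstDifference e) where
  eq_top_iff x y := by
    rw [← top_le_iff, le_firstDifference_iff]
    refine ⟨fun h => e.injective (funext fun i => h i (WithTop.coe_lt_top i)), ?_⟩
    rintro rfl _ _
    rfl
  comm x y := by
    refine eq_of_forall_le_iff fun γ => ?_
    rw [le_firstDifference_iff, le_firstDifference_iff]
    exact forall₂_congr fun _ _ => eq_comm
  trans γ x y z h1 h2 := by
    rw [le_firstDifference_iff] at *
    exact fun i hi => (h1 i hi).trans (h2 i hi)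
  binary i x y z h1 h2 := by
    rw [firstDifference_eq_coe_iff] at h1 h2
    rw [lt_iff_le_and_ne, le_firstDifference_iff]
    refine ⟨fun j hj => ?_, fun h => ?_⟩
    · have hj' := WithTop.coe_lt_coe.1 hj
      exact (h1.2 j hj').symm.trans (h2.2 j hj')
    · obtain ⟨h3, -⟩ := firstDifference_eq_coe_iff.1 h.symm
      revert h3
      have h1' := h1.1
      have h2' := h2.1
      revert h1' h2'
      cases e x i <;> cases e y i <;> cases e z i <;> simp
  complete C hC := by
    classical
    refine ⟨e.symm fun i =>
      if h : ∃ a ∈ C, (i : WithTop Q) < a.2 then e h.choose.1 i else false, fun a ha => ?_⟩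
    rw [le_firstDifference_iff]
    intro i hi
    have h : ∃ a ∈ C, (i : WithTop Q) < a.2 := ⟨a, ha, hi⟩
    rw [e.apply_symm_apply, dif_pos h]
    exact le_firstDifference_iff.1 (hC a ha _ h.choose_spec.1) i (lt_min hi h.choose_spec.2)
  comb c hc := by
    classical
    refine ⟨fun n => e.symm fun i => decide (i = c n), fun m n hmn => ?_⟩
    have hlt := hc hmn
    rw [firstDifference_eq_coe_iff, e.apply_symm_apply, e.apply_symm_apply]
    refine ⟨by simp [hlt.ne], fun j hj => ?_⟩
    simp [hj.ne, (hj.trans hlt).ne]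

end FirstDifference

/-! ### Uniform families on the natural numbers -/

section Uniform

variable {H : Set (Finset ℕ)}

theorem isCh_nat (A : Set ℕ) : IsCh A := fun a _ b _ _ => le_total a b

/-- If no section of `H` contains all finite subsets of an infinite set, then neither does `H`: a
set and its least element `n` are tested by the section at `n`. -/
theorem exists_notMem_of_sections {M A : Set ℕ} (hF : ∀ s ∈ H, (s : Set ℕ) ⊆ M)
    (h : ∀ n ∈ M, ∀ A : Set ℕ, A.Infinite → ∃ s : Finset ℕ, (s : Set ℕ) ⊆ A ∧ s ∉ sectionAt H n)
    (hA : A.Infinite) : ∃ s : Finset ℕ, (s : Set ℕ) ⊆ A ∧ s ∉ H := by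
  classical
  obtain ⟨n, hn, hmin⟩ := wellFounded_lt.has_min A hA.nonempty
  by_cases hnM : n ∈ M
  · obtain ⟨s, hs, hs'⟩ := h n hnM (A \ {n}) (hA.sdiff (Set.finite_singleton n))
    refine ⟨insert n s, ?_, fun hmem => hs' ⟨fun m hm => ?_, hmem⟩⟩
    · rw [Finset.coe_insert]
      exact Set.insert_subset hn (hs.trans Set.sdiff_subset)
    · exact lt_of_le_of_ne (not_lt.1 (hmin m (hs hm).1)) fun h => (hs hm).2 h.symm
  · exact ⟨{n}, by simpa using hn, fun hmem => hnM (hF _ hmem (by simp))⟩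

theorem IsUniform.exists_notMem {α : Ordinal.{0}} {M : Set ℕ} (h : IsUniform α M H) :
    ∀ A : Set ℕ, A.Infinite → ∃ s : Finset ℕ, (s : Set ℕ) ⊆ A ∧ s ∉ H := by
  induction h with
  | zero M _ =>
    intro A hA
    obtain ⟨n, hn⟩ := hA.nonempty
    exact ⟨{n}, by simpa using hn, by simp⟩
  | succ β M F _ hF _ _ ih => exact fun A hA => exists_notMem_of_sections hF ih hA
  | limit α M F a _ _ hF _ _ _ _ _ ih => exact fun A hA => exists_notMem_of_sections hF ih hA

theorem IsUniform.isCompactFamily {α : Ordinal.{0}} {M : Set ℕ} (h : IsUniform α M H)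
    (hH : IsHereditary H) : IsCompactFamily H :=
  (isCompactFamily_iff hH).2 h.exists_notMem

/-- A spreading hereditary family with a member of size `k` contains all sets of size at most `k`
beyond some number. -/
theorem mem_of_forall_lt (hH : IsHereditary H) (hs : IsSpreading H) {X t : Finset ℕ} (hX : X ∈ H)
    (ht : t.card ≤ X.card) (hlt : ∀ m ∈ X, ∀ n ∈ t, m ≤ n) : t ∈ H := by
  obtain ⟨Y, hYX, hY⟩ := Finset.exists_subset_card_eq ht
  have himg : ∀ (Z : Finset ℕ) {k : ℕ} (h : Z.card = k),
      Finset.univ.image (Z.orderEmbOfFin h) = Z := fun Z k h => by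
    rw [← Finset.coe_inj]
    simp
  have := hs t.card (Y.orderEmbOfFin hY) (t.orderEmbOfFin rfl) (OrderEmbedding.strictMono _)
    (OrderEmbedding.strictMono _)
    (fun i => hlt _ (hYX (Y.orderEmbOfFin_mem hY i)) _ (t.orderEmbOfFin_mem rfl i))
    (by rw [himg]; exact hH X hX Y hYX)
  rwa [himg] at this

/-- Beyond some number all sets of size at most `k` belong to `H`, so every restriction has rank at
least `k`. -/
theorem card_le_srk (hH : IsHereditary H) (hs : IsSpreading H) (hc : IsCompactFamily H)
    {X : Finset ℕ} (hX : X ∈ H) : (X.card : Ordinal.{0}) ≤ srk H := by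
  classical
  refine le_srk (exists_infinite_ch isCh_nat) fun C hC _ => ?_
  rw [le_rk_iff (hH.restrict C) (hc.restrict hH C) ⟨hH.empty_mem hX, by simp⟩]
  have key : ∀ j : ℕ, ∀ t : Finset ℕ, (t : Set ℕ) ⊆ C → (∀ n ∈ t, X.sup id < n) →
      t.card + j ≤ X.card → HasRk (restrict H C) j t := by
    intro j
    induction j with
    | zero =>
      intro t htC ht hcard
      rw [Nat.cast_zero, hasRk_zero]
      refine ⟨mem_of_forall_lt hH hs hX (by omega) fun m hm n hn => ?_, htC⟩
      exact (Finset.le_sup (f := id) hm).trans (ht n hn).le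
    | succ j ih =>
      intro t htC ht hcard
      rw [Nat.cast_add, Nat.cast_one, hasRk_add_one]
      refine ⟨(ih t htC ht (by omega)).mem, ?_⟩
      refine (hC.sdiff ((Finset.range (X.sup id + 1) ∪ t).finite_toSet)).mono ?_
      rintro i ⟨hiC, hi⟩
      rw [Finset.mem_coe, Finset.mem_union, Finset.mem_range, not_or, not_lt] at hi
      have := ih (insert i t) (by
        rw [Finset.coe_insert]
        exact Set.insert_subset hiC htC) (fun n hn => by
        rcases Finset.mem_insert.1 hn with rfl | hn
        · exact hi.1
        · exact ht n hn) (by rw [Finset.card_insert_of_notMem hi.2]; omega)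
      change HasRk _ _ _
      convert this
  exact key X.card ∅ (by simp) (by simp) (by simp)

theorem exists_card_le_of_srk_lt_omega0 (hH : H ∈ uniformFamilies) (h : srk H < ω) :
    ∃ k : ℕ, srk H = k ∧ ∀ X ∈ H, X.card ≤ k := by
  obtain ⟨hH, hs, α, hα⟩ := hH
  obtain ⟨k, hk⟩ := lt_omega0.1 h
  refine ⟨k, hk, fun X hX => ?_⟩
  have := card_le_srk hH hs (hα.isCompactFamily hH) hX
  rw [hk] at this
  exact_mod_cast this

end Uniform

/-! ### The basis on the branches of the full binary tree -/

theorem isCh_of_linearOrder {P : Type u} [LinearOrder P] (A : Set P) : IsCh A :=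
  fun a _ b _ _ => le_total a b

theorem hasPotential_treeFamily_of_mem {P Q : Type u} [LinearOrder Q] [Infinite Q]
    {Δ : P → P → WithTop Q} {B : FamilyBasis Q} {K : Set (Finset Q)}
    (hΔ : IsFirstDifference Δ) (hK : K ∈ B.carrier) (hω : ω ≤ srk K) :
    HasPotential (treeFamily Δ K) (iota (srk K)) := by
  have h := B.homogeneous K hK
  have hl := expIndecomposable_iota (srk K)
  exact hasPotential_treeFamily hΔ (h.isHereditary isCh_of_linearOrder) hl (omega0_lt_iota hω)
    (h.hasPotential isCh_of_linearOrder hl (omega0_lt_iota hω) le_rfl)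

theorem one_le_srk_cube {Q : Type u} [LinearOrder Q] [Infinite Q] {n : ℕ} (hn : 1 ≤ n) :
    1 ≤ srk (cube Q n) :=
  one_le_srk (exists_infinite_ch isCh_of_linearOrder) (cube_hereditary n)
    ((isHomogeneous_cube isCh_of_linearOrder n).isCompactFamily isCh_of_linearOrder)
    (cube_mono hn)

theorem iota_srk_cube {Q : Type u} [LinearOrder Q] [Infinite Q] (n : ℕ) :
    iota (srk (cube Q n)) = ω :=
  iota_of_lt_omega0 (srk_lt_omega0_of_subset_cube isCh_of_linearOrder
    (isHomogeneous_cube isCh_of_linearOrder n) subset_rfl)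

section Basis

variable {P Q : Type u} [LinearOrder P] [LinearOrder Q]

/-- The families on branches generated by a basis `B` on levels: homogeneous families that
consist of sets of bounded size, or whose members have their branching levels in a member of `B`
of infinite small rank with the same value of `ι`. -/
def treeCarrier (Δ : P → P → WithTop Q) (B : FamilyBasis Q) : Set (Set (Finset P)) :=
  {G | IsHomogeneous G ∧ ((∃ n, G ⊆ cube P n) ∨ ∃ K ∈ B.carrier, ω ≤ srk K ∧
    iota (srk K) = iota (srk G) ∧ G ⊆ treeFamily Δ K)}

variable {Δ : P → P → WithTop Q} {B : FamilyBasis Q} {E F G : Set (Finset P)}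
  {K K₁ K₂ : Set (Finset Q)}

theorem cube_subset_treeFamily (n : ℕ) : cube P n ⊆ treeFamily Δ (cube Q n) := by
  classical
  intro s hs x _
  refine ⟨isCh_of_linearOrder _, ?_⟩
  have h1 : (splits Δ x s).map ⟨fun i : Q => (i : WithTop Q), WithTop.coe_injective⟩ ⊆
      s.image (Δ x) := by
    intro γ hγ
    obtain ⟨i, hi, rfl⟩ := Finset.mem_map.1 hγ
    obtain ⟨y, hy, hxy⟩ := mem_splits.1 hi
    exact Finset.mem_image.2 ⟨y, hy, hxy⟩
  have h2 := Finset.card_le_card h1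
  rw [Finset.card_map] at h2
  exact h2.trans (Finset.card_image_le.trans hs.2)

/-- A member `x` of `s` sees `t` at the levels where the members of `t` leave `x`. These are
branching levels along the member of `t` nearest to `x`, and one more level. -/
theorem chainSup_treeFamily_subset (hΔ : IsFirstDifference Δ) (h₁ : IsHereditary K₁)
    (h₂ : IsHereditary K₂) (h₁0 : ∅ ∈ K₁) (h₂0 : ∅ ∈ K₂) :
    chainSup (treeFamily Δ K₁) (treeFamily Δ K₂) ⊆
      treeFamily Δ (chainSup (chainSup K₁ K₂) (cube Q 1)) := by
  classical
  have key : ∀ x : P, ∀ u : Finset P, ∀ s t : Finset P, ∀ a ∈ K₁, ∀ b ∈ K₂, ∀ e ∈ cube Q 1,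
      u = s ∪ t → (∀ y ∈ s, ∀ i : Q, Δ x y = i → i ∈ a ∨ i ∈ b ∨ i ∈ e) →
      (∀ y ∈ t, ∀ i : Q, Δ x y = i → i ∈ a ∨ i ∈ b ∨ i ∈ e) →
      splits Δ x u ∈ chainSup (chainSup K₁ K₂) (cube Q 1) := by
    rintro x _ s t a ha b hb e he rfl hs ht
    refine mem_chainSup_of_forall isCh_of_linearOrder (isHereditary_chainSup h₁ h₂)
      (cube_hereditary 1) (a := a ∪ b) (mem_chainSup_of_forall isCh_of_linearOrder h₁ h₂ ha hb
        fun i hi => by simpa using hi) he fun i hi => ?_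
    obtain ⟨y, hy, hxy⟩ := mem_splits.1 hi
    rw [Finset.mem_union, or_assoc]
    rcases Finset.mem_union.1 hy with hy | hy
    · exact hs y hy i hxy
    · exact ht y hy i hxy
  intro u hu x hx
  obtain ⟨-, s, hs, t, ht, rfl⟩ := mem_chainSup.1 hu
  rcases Finset.mem_union.1 hx with hx | hx
  · obtain ⟨b, hb, e, he, hbe⟩ :=
      exists_cover_firstDifference isCh_of_linearOrder hΔ h₂0 x ht
    exact key x _ s t _ (hs x hx) b hb e he rfl
      (fun y hy i hi => Or.inl (mem_splits.2 ⟨y, hy, hi⟩))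
      fun y hy i hi => Or.inr (hbe y hy i hi)
  · obtain ⟨a, ha, e, he, hae⟩ :=
      exists_cover_firstDifference isCh_of_linearOrder hΔ h₁0 x hs
    exact key x _ s t a ha _ (ht x hx) e he rfl
      (fun y hy i hi => (hae y hy i hi).imp id Or.inr)
      fun y hy i hi => Or.inr (Or.inl (mem_splits.2 ⟨y, hy, hi⟩))

theorem chainSup_cube_subset (m n : ℕ) : chainSup (cube P m) (cube P n) ⊆ cube P (m + n) := by
  classical
  intro u hu
  obtain ⟨h, s, hs, t, ht, rfl⟩ := mem_chainSup.1 hu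
  exact ⟨h, (Finset.card_union_le s t).trans (add_le_add hs.2 ht.2)⟩

theorem chainSup_mono {F' G' : Set (Finset P)} (hF : F ⊆ F') (hG : G ⊆ G') :
    chainSup F G ⊆ chainSup F' G' := fun _ ⟨h, s, hs, t, ht, hu⟩ =>
  ⟨h, s, hF hs, t, hG ht, hu⟩

theorem union_subset_chainSup (hF : ∅ ∈ F) (hG : ∅ ∈ G) : F ∪ G ⊆ chainSup F G :=
  Set.union_subset (subset_chainSup_left isCh_of_linearOrder hG)
    (subset_chainSup_right isCh_of_linearOrder hF)

theorem treeCarrier_bounded_or (hG : G ∈ treeCarrier Δ B) :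
    (∃ n, G ⊆ cube P n) ∨ ω < iota (srk G) := by
  obtain ⟨-, h | ⟨K, -, hω, hK, -⟩⟩ := hG
  · exact Or.inl h
  · exact Or.inr (hK ▸ omega0_lt_iota hω)

theorem IsMultiplication.manyUnions {H : Set (Finset ℕ)} {K L : Set (Finset Q)}
    (h : IsMultiplication K H L) : ManyUnions K H L := by
  intro u hu
  obtain ⟨φ, hφ, hX⟩ := h.subsequence u hu (isCh_of_linearOrder _)
  exact ⟨φ, hφ, fun X hX' => ⟨_, hX X hX',
    fun n hn i hi => by simpa using ⟨n, hn, hi⟩⟩⟩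

/-- If the product of the small ranks is finite, then a cube is a multiplication. -/
theorem exists_isMultiplication_of_lt_omega0 [Infinite P] {H : Set (Finset ℕ)}
    (hH : H ∈ uniformFamilies)
    (hF : F ∈ treeCarrier Δ B) (hlt : srk F * Ordinal.lift.{u} (srk H) < ω) :
    ∃ G ∈ treeCarrier Δ B, IsMultiplication F H G := by
  classical
  obtain ⟨m, hm⟩ : ∃ m : ℕ, ∀ s : ℕ → Finset P, (∀ n, s n ∈ F) → ∀ X ∈ H, ∀ S : Finset P,
      (∀ y ∈ S, ∃ n ∈ X, y ∈ s n) → S.card ≤ m := by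
    rcases hF.1.eq_or_one_le isCh_of_linearOrder with rfl | hF1
    · refine ⟨0, fun s hs X _ S hS => ?_⟩
      rw [Nat.le_zero, Finset.card_eq_zero]
      refine Finset.eq_empty_of_forall_notMem fun y hy => ?_
      obtain ⟨n, -, hyn⟩ := hS y hy
      rw [Set.mem_singleton_iff.1 (hs n)] at hyn
      exact Finset.notMem_empty y hyn
    · have hH' : srk H < ω := by
        by_contra! h
        refine hlt.not_ge (le_trans ?_ (le_mul_of_one_le_left' hF1))
        rwa [← Ordinal.lift_omega0.{u, 0}, Ordinal.lift_le]
      obtain ⟨k, hk, hkX⟩ := exists_card_le_of_srk_lt_omega0 hH hH'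
      rcases Nat.eq_zero_or_pos k with rfl | hk0
      · refine ⟨0, fun s _ X hX S hS => ?_⟩
        rw [Nat.le_zero, Finset.card_eq_zero]
        refine Finset.eq_empty_of_forall_notMem fun y hy => ?_
        obtain ⟨n, hn, -⟩ := hS y hy
        rw [Finset.card_eq_zero.1 (Nat.le_zero.1 (hkX X hX))] at hn
        exact Finset.notMem_empty n hn
      · have hk1 : 1 ≤ Ordinal.lift.{u} (srk H) := by
          rw [hk, Ordinal.lift_natCast]
          exact_mod_cast hk0
        have hFω : srk F < ω := (le_mul_of_one_le_right' hk1).trans_lt hlt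
        obtain ⟨n, hn⟩ := (treeCarrier_bounded_or hF).resolve_right
          (by rw [iota_of_lt_omega0 hFω]; exact lt_irrefl _)
        refine ⟨k * n, fun s hs X hX S hS => ?_⟩
        have hSX : S ⊆ X.biUnion s := fun y hy => Finset.mem_biUnion.2 (hS y hy)
        exact (Finset.card_le_card hSX).trans <|
          (Finset.card_biUnion_le_card_mul X s n fun a _ => (hn (hs a)).2).trans
          (Nat.mul_le_mul_right n (hkX X hX))
  have hcube := isHomogeneous_cube (P := P) isCh_of_linearOrder m
  refine ⟨cube P m, ⟨hcube, Or.inl ⟨m, subset_rfl⟩⟩, fun s _ => isCh_of_linearOrder _, hcube, ?_,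
    fun s hs _ => ⟨id, strictMono_id, fun X hX => ⟨isCh_of_linearOrder _,
      hm s hs X hX _ fun y hy => by simpa using hy⟩⟩⟩
  rw [iota_srk_cube, iota_of_lt_omega0 hlt]

variable [Infinite P] [Infinite Q]

theorem exists_subset_treeFamily (hG : G ∈ treeCarrier Δ B) :
    ∃ K ∈ B.carrier, 1 ≤ srk K ∧ iota (srk K) = iota (srk G) ∧ G ⊆ treeFamily Δ K := by
  obtain ⟨hG, ⟨n, hn⟩ | ⟨K, hK, hω, heq, hsub⟩⟩ := hG
  · refine ⟨cube Q (n + 1), B.cube_mem _, one_le_srk_cube (by omega), ?_,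
      hn.trans ((cube_mono n.le_succ).trans (cube_subset_treeFamily _))⟩
    rw [iota_srk_cube, iota_of_lt_omega0 (srk_lt_omega0_of_subset_cube isCh_of_linearOrder hG hn)]
  · exact ⟨K, hK, one_lt_omega0.le.trans hω, heq, hsub⟩

/-- The criterion by which families built from two families of the carrier belong to it. -/
theorem mem_treeCarrier_of_subset (hΔ : IsFirstDifference Δ) (hF : IsHomogeneous F)
    (hG : IsHomogeneous G) (hE : IsHereditary E) (hFE : F ⊆ E) (hGE : G ⊆ E)
    (h0 : F = {∅} → G = {∅} → E = {∅})
    (h : (∃ n, E ⊆ cube P n) ∨ ∃ K ∈ B.carrier, ω ≤ srk K ∧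
      iota (srk K) = max (iota (srk F)) (iota (srk G)) ∧ E ⊆ treeFamily Δ K) :
    E ∈ treeCarrier Δ B := by
  rcases h with ⟨n, hn⟩ | ⟨K, hK, hω, heq, hsub⟩
  · refine ⟨(isHomogeneous_of_subset_of_subset isCh_of_linearOrder hF hG hE hFE hGE ?_ h0).1,
      Or.inl ⟨n, hn⟩⟩
    exact ((hasPotential_cube n).subset hn).mono (le_max_of_le_left (omega0_le_iota _))
  · obtain ⟨h1, h2⟩ :=
      isHomogeneous_of_subset_of_subset isCh_of_linearOrder hF hG hE hFE hGE (by
        rw [← heq]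
        exact (hasPotential_treeFamily_of_mem hΔ hK hω).subset hsub) h0
    exact ⟨h1, Or.inr ⟨K, hK, hω, heq.trans h2.symm, hsub⟩⟩

theorem treeFamily_mem_treeCarrier [WellFoundedLT Q] (hΔ : IsFirstDifference Δ)
    (hK : K ∈ B.carrier) (hω : ω ≤ srk K) :
    treeFamily Δ K ∈ treeCarrier Δ B ∧ srk (treeFamily Δ K) = srk K := by
  have h := B.homogeneous K hK
  have hher := h.isHereditary isCh_of_linearOrder
  have hT := isHereditary_treeFamily (Δ := Δ) hher
  have hp := hasPotential_treeFamily_of_mem hΔ hK hω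
  have hc := isCompactFamily_of_hasPotential hT hp
  have h0 := h.empty_mem isCh_of_linearOrder
  have heq := srk_treeFamily isCh_of_linearOrder isCh_of_linearOrder hΔ hher
    (h.isCompactFamily isCh_of_linearOrder) h0 hc hω
  refine ⟨⟨(isHomogeneous_iff isCh_of_linearOrder).2 ⟨hT, hc, Or.inr ⟨?_, ?_, ?_⟩⟩,
    Or.inr ⟨K, hK, hω, by rw [heq], subset_rfl⟩⟩, heq⟩
  · exact (cube_subset_treeFamily 1).trans
      (treeFamily_mono (h.cube_subset isCh_of_linearOrder (one_lt_omega0.le.trans hω)))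
  · rw [heq]
    exact h.srk_lt_omega_one isCh_of_linearOrder
  · rw [heq]
    exact rk_lt_of_hasPotential hT (by simp [treeFamily]) hp

theorem treeCarrier_union (hΔ : IsFirstDifference Δ) (hF : F ∈ treeCarrier Δ B)
    (hG : G ∈ treeCarrier Δ B) : F ∪ G ∈ treeCarrier Δ B := by
  refine mem_treeCarrier_of_subset hΔ hF.1 hG.1 (isHereditary_union
    (hF.1.isHereditary isCh_of_linearOrder) (hG.1.isHereditary isCh_of_linearOrder))
    Set.subset_union_left Set.subset_union_right (by rintro rfl rfl; simp) ?_
  have hinf : ω < max (iota (srk F)) (iota (srk G)) → ∃ K ∈ B.carrier, ω ≤ srk K ∧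
      iota (srk K) = max (iota (srk F)) (iota (srk G)) ∧ F ∪ G ⊆ treeFamily Δ K := by
    intro hω
    obtain ⟨K₁, hK₁, h1, heq₁, hsub₁⟩ := exists_subset_treeFamily hF
    obtain ⟨K₂, hK₂, h2, heq₂, hsub₂⟩ := exists_subset_treeFamily hG
    rw [← heq₁, ← heq₂] at hω ⊢
    have h₁ := B.homogeneous _ hK₁
    have h₂ := B.homogeneous _ hK₂
    have hl := expIndecomposable_max (expIndecomposable_iota (srk K₁))
      (expIndecomposable_iota (srk K₂))
    have hher₁ := h₁.isHereditary isCh_of_linearOrder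
    have hher₂ := h₂.isHereditary isCh_of_linearOrder
    have heq := (isHomogeneous_of_subset_of_subset isCh_of_linearOrder h₁ h₂
      (isHereditary_union hher₁ hher₂) Set.subset_union_left Set.subset_union_right
      ((hasPotential_chainSup hher₁ hher₂ hl hω
        (h₁.hasPotential isCh_of_linearOrder hl hω (le_max_left _ _))
        (h₂.hasPotential isCh_of_linearOrder hl hω (le_max_right _ _))).subset
        (union_subset_chainSup (h₁.empty_mem isCh_of_linearOrder)
          (h₂.empty_mem isCh_of_linearOrder))) (by rintro rfl rfl; simp)).2
    refine ⟨_, B.union_mem _ hK₁ _ hK₂, omega0_le_of_lt_iota (by rwa [heq]), heq, ?_⟩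
    exact Set.union_subset (hsub₁.trans (treeFamily_mono Set.subset_union_left))
      (hsub₂.trans (treeFamily_mono Set.subset_union_right))
  rcases treeCarrier_bounded_or hF with ⟨m, hm⟩ | h
  · rcases treeCarrier_bounded_or hG with ⟨n, hn⟩ | h
    · exact Or.inl ⟨max m n, Set.union_subset (hm.trans (cube_mono (le_max_left _ _)))
        (hn.trans (cube_mono (le_max_right _ _)))⟩
    · exact Or.inr (hinf (lt_max_of_lt_right h))
  · exact Or.inr (hinf (lt_max_of_lt_left h))

theorem treeCarrier_chainSup (hΔ : IsFirstDifference Δ) (hF : F ∈ treeCarrier Δ B)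
    (hG : G ∈ treeCarrier Δ B) : chainSup F G ∈ treeCarrier Δ B := by
  classical
  refine mem_treeCarrier_of_subset hΔ hF.1 hG.1 (isHereditary_chainSup
    (hF.1.isHereditary isCh_of_linearOrder) (hG.1.isHereditary isCh_of_linearOrder))
    (subset_chainSup_left isCh_of_linearOrder (hG.1.empty_mem isCh_of_linearOrder))
    (subset_chainSup_right isCh_of_linearOrder (hF.1.empty_mem isCh_of_linearOrder)) ?_ ?_
  · rintro rfl rfl
    ext u
    rw [mem_chainSup]
    simp [isCh_of_linearOrder]
  have hinf : ω < max (iota (srk F)) (iota (srk G)) → ∃ K ∈ B.carrier, ω ≤ srk K ∧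
      iota (srk K) = max (iota (srk F)) (iota (srk G)) ∧ chainSup F G ⊆ treeFamily Δ K := by
    intro hω
    obtain ⟨K₁, hK₁, -, heq₁, hsub₁⟩ := exists_subset_treeFamily hF
    obtain ⟨K₂, hK₂, -, heq₂, hsub₂⟩ := exists_subset_treeFamily hG
    rw [← heq₁, ← heq₂] at hω ⊢
    have h₁ := B.homogeneous _ hK₁
    have h₂ := B.homogeneous _ hK₂
    obtain ⟨h3, heq⟩ := isHomogeneous_chainSup isCh_of_linearOrder h₁ h₂ hω
    have hω' : ω < max (iota (srk (chainSup K₁ K₂))) (iota (srk (cube Q 1))) :=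
      lt_max_of_lt_left (by rwa [heq])
    have heq' := (isHomogeneous_chainSup isCh_of_linearOrder h3
      (isHomogeneous_cube isCh_of_linearOrder 1) hω').2
    rw [heq, iota_srk_cube, max_eq_left hω.le] at heq'
    refine ⟨_, B.chainSup_mem _ (B.chainSup_mem _ hK₁ _ hK₂) _ (B.cube_mem 1),
      omega0_le_of_lt_iota (by rwa [heq']), heq', (chainSup_mono hsub₁ hsub₂).trans ?_⟩
    exact chainSup_treeFamily_subset hΔ (h₁.isHereditary isCh_of_linearOrder)
      (h₂.isHereditary isCh_of_linearOrder) (h₁.empty_mem isCh_of_linearOrder)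
      (h₂.empty_mem isCh_of_linearOrder)
  rcases treeCarrier_bounded_or hF with ⟨m, hm⟩ | h
  · rcases treeCarrier_bounded_or hG with ⟨n, hn⟩ | h
    · exact Or.inl ⟨m + n, (chainSup_mono hm hn).trans (chainSup_cube_subset m n)⟩
    · exact Or.inr (hinf (lt_max_of_lt_right h))
  · exact Or.inr (hinf (lt_max_of_lt_left h))

/-- Multiplications on the tree come from multiplications of `K` and of the singletons on the
levels. -/
theorem exists_isMultiplication [WellFoundedLT Q] (hΔ : IsFirstDifference Δ)
    {H : Set (Finset ℕ)} (hH : H ∈ uniformFamilies) (hF : F ∈ treeCarrier Δ B) :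
    ∃ G ∈ treeCarrier Δ B, IsMultiplication F H G := by
  classical
  rcases lt_or_ge (srk F * Ordinal.lift.{u} (srk H)) ω with hlt | hω
  · exact exists_isMultiplication_of_lt_omega0 hH hF hlt
  have hne : srk F * Ordinal.lift.{u} (srk H) ≠ 0 := (omega0_pos.trans_le hω).ne'
  have hF1 : 1 ≤ srk F := by
    rw [Order.one_le_iff_pos, pos_iff_ne_zero]
    exact fun h => hne (by rw [h, zero_mul])
  have hH1 : 1 ≤ Ordinal.lift.{u} (srk H) := by
    rw [Order.one_le_iff_pos, pos_iff_ne_zero]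
    exact fun h => hne (by rw [h, mul_zero])
  obtain ⟨K, hK, hK1, heq, hsub⟩ := exists_subset_treeFamily hF
  have hKm := B.mul_isMultiplication K hK H hH
  have h1m := B.mul_isMultiplication _ (B.cube_mem 1) H hH
  have hKh := B.homogeneous K hK
  have hLh := hKm.homogeneous
  have hL'h := h1m.homogeneous
  have hιL : iota (srk (B.mul K H)) = iota (srk F * Ordinal.lift.{u} (srk H)) := by
    rw [hKm.iota_srk, iota_mul hK1 hH1, iota_mul hF1 hH1, heq]
  have hl := expIndecomposable_iota (srk (B.mul K H))
  have hlω : ω < iota (srk (B.mul K H)) := by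
    rw [hιL]
    exact omega0_lt_iota hω
  have hKl : iota (srk K) ≤ iota (srk (B.mul K H)) := by
    rw [hKm.iota_srk, iota_mul hK1 hH1]
    exact le_max_left _ _
  have hL'l : iota (srk (B.mul (cube Q 1) H)) ≤ iota (srk (B.mul K H)) := by
    rw [h1m.iota_srk, hKm.iota_srk, iota_mul (one_le_srk_cube le_rfl) hH1, iota_mul hK1 hH1,
      iota_srk_cube]
    exact max_le_max (omega0_le_iota _) le_rfl
  have her := fun {A : Set (Finset Q)} (h : IsHomogeneous A) =>
    h.isHereditary isCh_of_linearOrder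
  have hem := fun {A : Set (Finset Q)} (h : IsHomogeneous A) => h.empty_mem isCh_of_linearOrder
  have hpot := fun {A : Set (Finset Q)} (h : IsHomogeneous A)
    (h' : iota (srk A) ≤ iota (srk (B.mul K H))) =>
    h.hasPotential isCh_of_linearOrder hl hlω h'
  have hc1 := isHomogeneous_cube (P := Q) isCh_of_linearOrder 1
  have hA := isHereditary_chainSup (her hKh) (her hc1)
  have hB := isHereditary_chainSup (her hLh) (her hL'h)
  have hK'mem := B.chainSup_mem _ (B.chainSup_mem _ hK _ (B.cube_mem 1)) _
    (B.chainSup_mem _ (B.mul_mem K hK H hH) _ (B.mul_mem _ (B.cube_mem 1) H hH))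
  set K' := chainSup (chainSup K (cube Q 1)) (chainSup (B.mul K H) (B.mul (cube Q 1) H)) with hK'
  have hιK' : iota (srk K') = iota (srk (B.mul K H)) := by
    refine (isHomogeneous_of_hasPotential isCh_of_linearOrder hLh
      (isHereditary_chainSup hA hB) ?_ ?_ ?_).2
    · refine (subset_chainSup_left isCh_of_linearOrder (hem hL'h)).trans
        (subset_chainSup_right isCh_of_linearOrder ?_)
      exact subset_chainSup_left isCh_of_linearOrder (hem hc1) (hem hKh)
    · refine hasPotential_chainSup hA hB hl hlω ?_ ?_
      · refine hasPotential_chainSup (her hKh) (her hc1) hl hlω (hpot hKh hKl) (hpot hc1 ?_)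
        rw [iota_srk_cube]
        exact hlω.le
      · exact hasPotential_chainSup (her hLh) (her hL'h) hl hlω (hpot hLh le_rfl)
          (hpot hL'h hL'l)
    · intro h
      rw [h, srk_singleton_empty (exists_infinite_ch isCh_of_linearOrder),
        iota_of_lt_omega0 omega0_pos] at hlω
      exact absurd hlω (lt_irrefl _)
  have hK'ω : ω ≤ srk K' := omega0_le_of_lt_iota (by rwa [hιK'])
  obtain ⟨hG, hsrk⟩ := treeFamily_mem_treeCarrier hΔ hK'mem hK'ω
  refine ⟨_, hG, fun s _ => isCh_of_linearOrder _, hG.1, by rw [hsrk, hιK', hιL],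
    fun s hs _ => ?_⟩
  obtain ⟨Φ, hΦ, -⟩ := hasPotential_treeFamily hΔ (her hKh) hl hlω (hpot hKh hKl)
  obtain ⟨φ, hφ, h⟩ := exists_subseq_mem_treeFamily isCh_of_linearOrder hΔ (her hKh) (her hLh)
    (her hL'h) (hem hKh) (hem hLh) (hem hL'h) hΦ hH.2.1 hKm.manyUnions h1m.manyUnions s
    fun n => hsub (hs n)
  exact ⟨φ, hφ, fun X hX => h X hX _ fun y hy => by simpa using hy⟩

open scoped Classical in
/-- A basis on the branches of the full binary tree from a basis on its levels. -/
noncomputable def treeBasis [WellFoundedLT Q] (hΔ : IsFirstDifference Δ) (B : FamilyBasis Q) :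
    FamilyBasis P where
  exists_infinite_chain := exists_infinite_ch isCh_of_linearOrder
  carrier := treeCarrier Δ B
  mul F H := if h : F ∈ treeCarrier Δ B ∧ H ∈ uniformFamilies then
    (exists_isMultiplication hΔ h.2 h.1).choose else ∅
  homogeneous F hF := hF.1
  cube_mem n := ⟨isHomogeneous_cube isCh_of_linearOrder n, Or.inl ⟨n, subset_rfl⟩⟩
  exists_srk_eq α hα hα₁ := by
    obtain ⟨K, hK, rfl⟩ := B.exists_srk_eq α hα hα₁
    exact ⟨_, treeFamily_mem_treeCarrier hΔ hK hα⟩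
  union_mem F hF G hG := treeCarrier_union hΔ hF hG
  chainSup_mem F hF G hG := treeCarrier_chainSup hΔ hF hG
  subfamily_mem F G hG hFG hF heq := ⟨hF, hG.2.imp (fun ⟨n, hn⟩ => ⟨n, hFG.trans hn⟩)
    fun ⟨K, hK, hω, hι, hsub⟩ => ⟨K, hK, hω, hι.trans heq.symm, hFG.trans hsub⟩⟩
  mul_mem F hF H hH := by
    rw [dif_pos ⟨hF, hH⟩]
    exact (exists_isMultiplication hΔ hH hF).choose_spec.1
  mul_isMultiplication F hF H hH := by
    rw [dif_pos ⟨hF, hH⟩]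
    exact (exists_isMultiplication hΔ hH hF).choose_spec.2

end Basis

end FamilyBases

theorem mainTheorem5 (κ : Cardinal.{u}) (hκ : ℵ₀ ≤ κ)
    (h : FamilyBases.CardinalHasBasis κ) :
    FamilyBases.CardinalHasBasis ((2 : Cardinal.{u}) ^ κ) := by
  obtain ⟨B⟩ := h
  have hQ : Infinite κ.ord.ToType := by
    rw [Cardinal.infinite_iff, Cardinal.mk_ord_toType]
    exact hκ
  have hP : Infinite ((2 : Cardinal.{u}) ^ κ).ord.ToType := by
    rw [Cardinal.infinite_iff, Cardinal.mk_ord_toType]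
    exact hκ.trans (Cardinal.cantor κ).le
  obtain ⟨e⟩ : Nonempty (((2 : Cardinal.{u}) ^ κ).ord.ToType ≃ (κ.ord.ToType → Bool)) := by
    rw [← Cardinal.eq]
    simp
  exact ⟨FamilyBases.treeBasis
    (FamilyBases.isFirstDifference_firstDifference (e := e)) B⟩
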